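/- Let $n=k_1+\dots+k_m$ with $n\ge 1$ and positive integers $k_1,\dots,k_m$, which split $\{1,\dots,n\}$ into $m$ consecutive blocks $B_1,\dots,B_m$ of lengths $k_1,\dots,k_m$. Let $b_1,\dots,b_n>0$ be real numbers such that $b_j=b_{j'}$ if and only if $j$ and $j'$ lie in the same block, and let $p_j,r_j\in\{-1,1\}$ for $j=1,\dots,n$. On $\mathbb{R}^{2n+1}$ with coordinates $(x,y,z)=(x_1,\dots,x_n,y_1,\dots,y_n,z)$ consider the deformed Heisenberg multiplication $$(x,y,z)*(x',y',z')=\Big(x+x',\,y+y',\,z+z'+\tfrac12\sum_{j=1}^n b_j\,(y_jx'_j-y'_jx_j)\Big),$$ its left-invariant vector fields $X_j=\partial_{x_j}+\tfrac{b_j}{2}y_j\,\partial_z$ and $Y_j=\partial_{y_j}-\tfrac{b_j}{2}x_j\,\partial_z$, the contact distribution $H=\mathrm{span}\{X_1,Y_1,\dots,X_n,Y_n\}$, and the metric $g$ on $H$ for which the frame $X_1,Y_1,\dots,X_n,Y_n$ is orthonormal with $g(X_j,X_j)=p_j$ and $g(Y_j,Y_j)=r_j$. Let $\omega=\sum_j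 b_j\,dx_j\wedge dy_j$ on $H$, let $H^i=\mathrm{span}\{X_j,Y_j : j\in B_i\}$, and let $$G_{g,\omega}=\prod_{i=1}^m\big(Sp(\omega|_{H^i})\cap O(g|_{H^i})\big),$$ written as matrices in the frames $X_j,Y_j$. An isometry of $(\mathbb{R}^{2n+1},H,g)$ is a smooth diffeomorphism $f$ with $f_*H=H$ such that every $f_*\colon H_q\to H_{f(q)}$ is a linear isometry. It is orientation preserving if it preserves the orientations of both the tangent bundle of $\mathbb{R}^{2n+1}$ and the bundle $H$. (1) The group of orientation-preserving isometries of $(\mathbb{R}^{2n+1},H,g)$, with the compact-open topology, is isomorphic as a topological group to the semidirect product $\mathbb{R}^{2n+1}\ltimes G_{g,\omega}$. Here $\mathbb{R}^{2n+1}$ carries the multiplication $*$, and $\sigma\in G_{g,\omega}$ acts on it by $(x,y,z)\mapsto(\sigma\cdot(x,y),z)$. (2) Let $J\colon H\to H$ be given by $\omega(v,w)=g(Jv,w)$, let $\hat H\subset H$ be the sum of the real eigenspaces of $J$ belonging to its purely imaginary eigenvalues, and let $s_i=\tfrac12\,\mathrm{rk}(H^i\cap\hat H)$. Then the Lie group of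 all isometries of $(\mathbb{R}^{2n+1},H,g)$ has dimension exactly $$2n+1+\sum_{i=1}^m\big(s_i^2+(k_i-s_i)^2\big).$$ That is, the space of vector fields generating smooth one-parameter groups of isometries has this dimension. -/

import Mathlib

open scoped ContDiff

namespace SubPseudoRiem

noncomputable section

/-- The space `ℝ^{2n+1}` with coordinates `(x₁, …, xₙ, y₁, …, yₙ, z)`:
`q.1 (Sum.inl i) = xᵢ`, `q.1 (Sum.inr i) = yᵢ` and `q.2 = z`. -/
abbrev Coord (n : ℕ) : Type := (Fin n ⊕ Fin n → ℝ) × ℝ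

/-! ### The structure `(H, g)` on `ℝ^{2n+1}` -/

/-- The vector fields `Xᵢ = ∂/∂xᵢ + (bᵢ/2) yᵢ ∂/∂z` (index `Sum.inl i`) and
`Yᵢ = ∂/∂yᵢ - (bᵢ/2) xᵢ ∂/∂z` (index `Sum.inr i`), as functions of the point `q`. -/
def frame {n : ℕ} (b : Fin n → ℝ) : Fin n ⊕ Fin n → Coord n → Coord n
  | Sum.inl i, q => (Pi.single (Sum.inl i) 1, b i / 2 * q.1 (Sum.inr i))
  | Sum.inr i, q => (Pi.single (Sum.inr i) 1, -(b i / 2 * q.1 (Sum.inl i)))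

/-- The distribution `H = span {X₁, Y₁, …, Xₙ, Yₙ}`. -/
def dist {n : ℕ} (b : Fin n → ℝ) (q : Coord n) : Submodule ℝ (Coord n) :=
  Submodule.span ℝ (Set.range fun k => frame b k q)

/-- The metric `g` on `H` for which `X₁, …, Xₙ, Y₁, …, Yₙ` is orthonormal with `g(Xᵢ, Xᵢ) = pᵢ` and
`g(Yᵢ, Yᵢ) = rᵢ`.  The coefficients of a vector `v` of `H` in this frame are the components of
`v.1`, at every point; the formula is only ever used on vectors of `H`. -/
def metric {n : ℕ} (p r : Fin n → ℝ) (v w : Coord n) : ℝ :=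
  ∑ i, (p i * v.1 (Sum.inl i) * w.1 (Sum.inl i) + r i * v.1 (Sum.inr i) * w.1 (Sum.inr i))

/-- The symplectic form `ω = ∑ bᵢ dxᵢ ∧ dyᵢ` on `H`, on coefficient vectors in the frame
`X₁, …, Xₙ, Y₁, …, Yₙ`. -/
def symp {n : ℕ} (b : Fin n → ℝ) (v w : Fin n ⊕ Fin n → ℝ) : ℝ :=
  ∑ i, b i * (v (Sum.inl i) * w (Sum.inr i) - v (Sum.inr i) * w (Sum.inl i))

/-- Gram matrix of `g` in the frame `X₁, …, Xₙ, Y₁, …, Yₙ`. -/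
def gramMetric {n : ℕ} (p r : Fin n → ℝ) : Matrix (Fin n ⊕ Fin n) (Fin n ⊕ Fin n) ℝ :=
  Matrix.diagonal (Sum.elim p r)

/-- Gram matrix of `ω` in the frame `X₁, …, Xₙ, Y₁, …, Yₙ`. -/
def gramSymp {n : ℕ} (b : Fin n → ℝ) : Matrix (Fin n ⊕ Fin n) (Fin n ⊕ Fin n) ℝ :=
  Matrix.fromBlocks 0 (Matrix.diagonal b) (-Matrix.diagonal b) 0

open Matrix in
theorem metric_eq {n : ℕ} (p r : Fin n → ℝ) (v w : Coord n) :
    metric p r v w = v.1 ⬝ᵥ gramMetric p r *ᵥ w.1 := by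
  simp only [metric, gramMetric, dotProduct, mulVec_diagonal, Fintype.sum_sum_type, Sum.elim_inl,
    Sum.elim_inr, Finset.sum_add_distrib]
  congr 1 <;> exact Finset.sum_congr rfl fun i _ => by ring

open Matrix in
theorem symp_eq {n : ℕ} (b : Fin n → ℝ) (v w : Fin n ⊕ Fin n → ℝ) :
    symp b v w = v ⬝ᵥ gramSymp b *ᵥ w := by
  simp only [symp, gramSymp, dotProduct, fromBlocks_mulVec, Fintype.sum_sum_type, Sum.elim_inl,
    Sum.elim_inr, zero_mulVec, neg_mulVec, mulVec_diagonal,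
    Pi.neg_apply, Function.comp_apply, zero_add, add_zero, ← Finset.sum_add_distrib]
  exact Finset.sum_congr rfl fun i _ => by ring

/-! ### Isometries -/

/-- `f` is an isometry of `(ℝ^{2n+1}, H, g)`: a diffeomorphism with `f_* H = H` whose differential
restricts to linear isometries `H_q → H_{f(q)}`. -/
structure IsIsometry {n : ℕ} (b p r : Fin n → ℝ) (f : Equiv.Perm (Coord n)) : Prop where
  smooth : ContDiff ℝ ∞ f
  smooth_symm : ContDiff ℝ ∞ f.symm
  map_dist : ∀ q, (dist b q).map (fderiv ℝ f q : Coord n →ₗ[ℝ] Coord n) = dist b (f q)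
  map_metric : ∀ q, ∀ v ∈ dist b q, ∀ w ∈ dist b q,
    metric p r (fderiv ℝ f q v) (fderiv ℝ f q w) = metric p r v w

/-- `f` preserves the orientation of the tangent bundle of `ℝ^{2n+1}`, and it preserves the
orientation of `H`: the matrix of `f_* : H_q → H_{f(q)}` with respect to the global frame
`X₁, …, Xₙ, Y₁, …, Yₙ` exists and has positive determinant. -/
structure IsOrientationPreserving {n : ℕ} (b : Fin n → ℝ) (f : Equiv.Perm (Coord n)) : Prop where
  tangent : ∀ q, 0 < LinearMap.det (fderiv ℝ f q : Coord n →ₗ[ℝ] Coord n)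
  horizontal : ∀ q, ∃ A : Matrix (Fin n ⊕ Fin n) (Fin n ⊕ Fin n) ℝ,
    (∀ k, fderiv ℝ f q (frame b k q) = ∑ l, A l k • frame b l (f q)) ∧ 0 < A.det

theorem perm_apply_inv {α : Type*} (f : Equiv.Perm α) (q : α) : f (f⁻¹ q) = q :=
  f.apply_symm_apply q

theorem fderiv_perm_mul {n : ℕ} {f h : Equiv.Perm (Coord n)} (hf : ContDiff ℝ ∞ f)
    (hh : ContDiff ℝ ∞ h) (q : Coord n) :
    fderiv ℝ (f * h : Equiv.Perm (Coord n)) q = (fderiv ℝ f (h q)).comp (fderiv ℝ h q) :=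
  fderiv_comp q (hf.differentiable (by simp) _) (hh.differentiable (by simp) _)

theorem fderiv_perm_one {n : ℕ} (q : Coord n) :
    fderiv ℝ (1 : Equiv.Perm (Coord n)) q = ContinuousLinearMap.id ℝ (Coord n) :=
  fderiv_id

theorem fderiv_perm_inv {n : ℕ} {f : Equiv.Perm (Coord n)} (hf : ContDiff ℝ ∞ f)
    (hf' : ContDiff ℝ ∞ f.symm) (q : Coord n) :
    (fderiv ℝ (f⁻¹ : Equiv.Perm (Coord n)) q).comp (fderiv ℝ f (f⁻¹ q)) =
        ContinuousLinearMap.id ℝ (Coord n) ∧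
      (fderiv ℝ f (f⁻¹ q)).comp (fderiv ℝ (f⁻¹ : Equiv.Perm (Coord n)) q) =
        ContinuousLinearMap.id ℝ (Coord n) := by
  have h1 := fderiv_perm_mul (f := f⁻¹) (h := f) hf' hf (f⁻¹ q)
  have h2 := fderiv_perm_mul (f := f) (h := f⁻¹) hf hf' q
  rw [inv_mul_cancel, fderiv_perm_one, perm_apply_inv] at h1
  rw [mul_inv_cancel, fderiv_perm_one] at h2
  exact ⟨h1.symm, h2.symm⟩

theorem IsIsometry.one {n : ℕ} (b p r : Fin n → ℝ) : IsIsometry b p r 1 where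
  smooth := contDiff_id
  smooth_symm := contDiff_id
  map_dist q := by rw [fderiv_perm_one]; exact Submodule.map_id _
  map_metric q v _ w _ := by rw [fderiv_perm_one]; rfl

theorem IsIsometry.map_mem {n : ℕ} {b p r : Fin n → ℝ} {f : Equiv.Perm (Coord n)}
    (hf : IsIsometry b p r f) {q v : Coord n} (hv : v ∈ dist b q) :
    fderiv ℝ f q v ∈ dist b (f q) := by
  rw [← hf.map_dist q]; exact Submodule.mem_map_of_mem hv

theorem IsIsometry.mul {n : ℕ} {b p r : Fin n → ℝ} {f h : Equiv.Perm (Coord n)}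
    (hf : IsIsometry b p r f) (hh : IsIsometry b p r h) : IsIsometry b p r (f * h) where
  smooth := hf.smooth.comp hh.smooth
  smooth_symm := hh.smooth_symm.comp hf.smooth_symm
  map_dist q := by
    rw [fderiv_perm_mul hf.smooth hh.smooth]
    exact (Submodule.map_comp _ _ _).trans ((congrArg _ (hh.map_dist q)).trans (hf.map_dist (h q)))
  map_metric q v hv w hw := by
    rw [fderiv_perm_mul hf.smooth hh.smooth]
    exact (hf.map_metric (h q) _ (hh.map_mem hv) _ (hh.map_mem hw)).trans
      (hh.map_metric q v hv w hw)

theorem IsIsometry.inv {n : ℕ} {b p r : Fin n → ℝ} {f : Equiv.Perm (Coord n)}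
    (hf : IsIsometry b p r f) : IsIsometry b p r f⁻¹ := by
  have key : ∀ q, ∀ v ∈ dist b q, ∃ u ∈ dist b (f⁻¹ q), fderiv ℝ f (f⁻¹ q) u = v ∧
      fderiv ℝ (f⁻¹ : Equiv.Perm (Coord n)) q v = u := by
    intro q v hv
    have h := hf.map_dist (f⁻¹ q)
    rw [perm_apply_inv] at h
    rw [← h] at hv
    obtain ⟨u, hu, rfl⟩ := hv
    exact ⟨u, hu, rfl,
      DFunLike.congr_fun (fderiv_perm_inv hf.smooth hf.smooth_symm q).1 u⟩
  refine ⟨hf.smooth_symm, hf.smooth, fun q => ?_, fun q v hv w hw => ?_⟩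
  · apply le_antisymm
    · rintro _ ⟨v, hv, rfl⟩
      obtain ⟨u, hu, -, h⟩ := key q v hv
      exact (congrArg (· ∈ dist b (f⁻¹ q)) h).mpr hu
    · intro u hu
      refine ⟨fderiv ℝ f (f⁻¹ q) u, ?_,
        DFunLike.congr_fun (fderiv_perm_inv hf.smooth hf.smooth_symm q).1 u⟩
      have := hf.map_mem hu
      rwa [perm_apply_inv] at this
  · obtain ⟨u, hu, rfl, h⟩ := key q v hv
    obtain ⟨u', hu', rfl, h'⟩ := key q w hw
    rw [h, h']
    exact (hf.map_metric _ u hu u' hu').symm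

theorem IsOrientationPreserving.one {n : ℕ} (b : Fin n → ℝ) : IsOrientationPreserving b 1 where
  tangent q := by rw [fderiv_perm_one]; simp
  horizontal q := ⟨1, fun k => by rw [fderiv_perm_one]; simp [Matrix.one_apply], by simp⟩

theorem IsOrientationPreserving.mul {n : ℕ} {b p r : Fin n → ℝ} {f h : Equiv.Perm (Coord n)}
    (hf : IsIsometry b p r f) (hh : IsIsometry b p r h)
    (hf' : IsOrientationPreserving b f) (hh' : IsOrientationPreserving b h) :
    IsOrientationPreserving b (f * h) where
  tangent q := by
    rw [fderiv_perm_mul hf.smooth hh.smooth]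
    have e := LinearMap.det_comp (fderiv ℝ f (h q) : Coord n →ₗ[ℝ] Coord n)
      (fderiv ℝ h q : Coord n →ₗ[ℝ] Coord n)
    exact (mul_pos (hf'.tangent (h q)) (hh'.tangent q)).trans_eq e.symm
  horizontal q := by
    obtain ⟨A, hA, hA'⟩ := hf'.horizontal (h q)
    obtain ⟨B, hB, hB'⟩ := hh'.horizontal q
    refine ⟨A * B, fun k => ?_, by rw [Matrix.det_mul]; exact mul_pos hA' hB'⟩
    rw [fderiv_perm_mul hf.smooth hh.smooth, ContinuousLinearMap.comp_apply, hB, map_sum]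
    simp only [map_smul, hA, Finset.smul_sum, Matrix.mul_apply, Finset.sum_smul, smul_smul]
    rw [Finset.sum_comm]
    exact Finset.sum_congr rfl fun l _ => Finset.sum_congr rfl fun m _ => by rw [mul_comm]; rfl

theorem IsOrientationPreserving.inv {n : ℕ} {b p r : Fin n → ℝ} {f : Equiv.Perm (Coord n)}
    (hf : IsIsometry b p r f) (hf' : IsOrientationPreserving b f) :
    IsOrientationPreserving b f⁻¹ where
  tangent q := by
    have h := congrArg (fun L : Coord n →L[ℝ] Coord n => LinearMap.det (L : Coord n →ₗ[ℝ] Coord n))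
      (fderiv_perm_inv hf.smooth hf.smooth_symm q).2
    have e := LinearMap.det_comp (fderiv ℝ f (f⁻¹ q) : Coord n →ₗ[ℝ] Coord n)
      (fderiv ℝ (f⁻¹ : Equiv.Perm (Coord n)) q : Coord n →ₗ[ℝ] Coord n)
    have h1 := e.symm.trans (h.trans LinearMap.det_id)
    exact pos_of_mul_pos_right (h1 ▸ one_pos) (hf'.tangent (f⁻¹ q)).le
  horizontal q := by
    obtain ⟨A, hA, hA'⟩ := hf'.horizontal (f⁻¹ q)
    rw [perm_apply_inv] at hA
    refine ⟨A⁻¹, fun k => ?_, by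
      rw [Matrix.det_nonsing_inv, Ring.inverse_eq_inv']; exact inv_pos.mpr hA'⟩
    have hu : IsUnit A.det := hA'.ne'.isUnit
    have h1 : frame b k q = ∑ l, A⁻¹ l k • fderiv ℝ f (f⁻¹ q) (frame b l (f⁻¹ q)) := by
      simp only [hA, Finset.smul_sum, smul_smul]
      rw [Finset.sum_comm]
      have : ∀ m, ∑ l, (A⁻¹ l k * A m l) • frame b m q =
          (1 : Matrix (Fin n ⊕ Fin n) (Fin n ⊕ Fin n) ℝ) m k • frame b m q := by
        intro m
        rw [← Matrix.mul_nonsing_inv A hu, Matrix.mul_apply, ← Finset.sum_smul]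
        exact congrArg (· • frame b m q) (Finset.sum_congr rfl fun l _ => mul_comm _ _)
      simp [this, Matrix.one_apply]
    rw [h1, map_sum]
    refine Finset.sum_congr rfl fun l _ => ?_
    rw [map_smul]
    exact congrArg _ (DFunLike.congr_fun (fderiv_perm_inv hf.smooth hf.smooth_symm q).1 _)

/-- The group of all isometries of `(ℝ^{2n+1}, H, g)`. -/
def isometryGroup {n : ℕ} (b p r : Fin n → ℝ) : Subgroup (Equiv.Perm (Coord n)) where
  carrier := {f | IsIsometry b p r f}
  mul_mem' hf hh := hf.mul hh
  one_mem' := IsIsometry.one b p r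
  inv_mem' hf := hf.inv

/-- The group of orientation preserving isometries of `(ℝ^{2n+1}, H, g)`. -/
def orientedIsometryGroup {n : ℕ} (b p r : Fin n → ℝ) : Subgroup (Equiv.Perm (Coord n)) where
  carrier := {f | IsIsometry b p r f ∧ IsOrientationPreserving b f}
  mul_mem' hf hh := ⟨hf.1.mul hh.1, hf.2.mul hf.1 hh.1 hh.2⟩
  one_mem' := ⟨IsIsometry.one b p r, IsOrientationPreserving.one b⟩
  inv_mem' hf := ⟨hf.1.inv, hf.2.inv hf.1⟩

/-- An orientation preserving isometry as a continuous map. -/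
def toContinuousMap {n : ℕ} (b p r : Fin n → ℝ) (f : orientedIsometryGroup b p r) :
    C(Coord n, Coord n) :=
  ⟨f.1, f.2.1.smooth.continuous⟩

/-- The compact-open topology on the group of orientation preserving isometries. -/
instance instTopologicalSpaceIsometries {n : ℕ} (b p r : Fin n → ℝ) :
    TopologicalSpace (orientedIsometryGroup b p r) :=
  TopologicalSpace.induced (toContinuousMap b p r) inferInstance

/-- The Lie algebra of the isometry group: the vector fields `V = d/dt|₀ φ_t` generating the smooth
one-parameter groups `(φ_t)` of isometries. -/
def infinitesimalIsometries {n : ℕ} (b p r : Fin n → ℝ) : Set (Coord n → Coord n) :=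
  {V | ∃ φ : Multiplicative ℝ →* isometryGroup b p r,
    ContDiff ℝ ∞ (fun s : ℝ × Coord n => (φ (Multiplicative.ofAdd s.1)).1 s.2) ∧
      ∀ q, V q = deriv (fun t : ℝ => (φ (Multiplicative.ofAdd t)).1 q) 0}

/-- The dimension of the Lie group of all isometries, i.e. the dimension of its Lie algebra. -/
def isometryGroupDim {n : ℕ} (b p r : Fin n → ℝ) : ℕ :=
  Module.finrank ℝ (Submodule.span ℝ (infinitesimalIsometries b p r))

/-! ### The deformed Heisenberg group -/

/-- The deformed Heisenberg group: `ℝ^{2n+1}`, with the points `(x₁, …, xₙ, y₁, …, yₙ, z)` written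
as `xy (Sum.inl i) = xᵢ`, `xy (Sum.inr i) = yᵢ`, and with the multiplication given by the weights
`b`. -/
@[ext]
structure Heis {n : ℕ} (b : Fin n → ℝ) where
  xy : Fin n ⊕ Fin n → ℝ
  z : ℝ

/-- The usual topology of `ℝ^{2n+1}`. -/
instance instTopologicalSpaceHeis {n : ℕ} (b : Fin n → ℝ) : TopologicalSpace (Heis b) :=
  TopologicalSpace.induced (fun q => ((q.xy, q.z) : Coord n)) inferInstance

/-- The deformed Heisenberg multiplication
`(x, y, z) * (x', y', z') = (x + x', y + y', z + z' + ½ ∑ bᵢ (yᵢ x'ᵢ - y'ᵢ xᵢ))`. -/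
instance instMulHeis {n : ℕ} (b : Fin n → ℝ) : Mul (Heis b) where
  mul q q' := ⟨q.xy + q'.xy, q.z + q'.z + 1 / 2 *
    ∑ i, b i * (q.xy (Sum.inr i) * q'.xy (Sum.inl i) - q'.xy (Sum.inr i) * q.xy (Sum.inl i))⟩

theorem Heis.mul_eq {n : ℕ} {b : Fin n → ℝ} (q q' : Heis b) :
    q * q' = ⟨q.xy + q'.xy, q.z + q'.z - 1 / 2 * symp b q.xy q'.xy⟩ := by
  change (⟨_, _⟩ : Heis b) = _
  refine Heis.ext rfl ?_
  simp only [symp, sub_eq_add_neg, ← mul_neg, ← Finset.sum_neg_distrib]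
  congr 2
  exact Finset.sum_congr rfl fun i _ => by ring

theorem symp_add_left {n : ℕ} (b : Fin n → ℝ) (u v w : Fin n ⊕ Fin n → ℝ) :
    symp b (u + v) w = symp b u w + symp b v w := by
  simp only [symp, ← Finset.sum_add_distrib, Pi.add_apply]
  exact Finset.sum_congr rfl fun i _ => by ring

theorem symp_add_right {n : ℕ} (b : Fin n → ℝ) (u v w : Fin n ⊕ Fin n → ℝ) :
    symp b u (v + w) = symp b u v + symp b u w := by
  simp only [symp, ← Finset.sum_add_distrib, Pi.add_apply]
  exact Finset.sum_congr rfl fun i _ => by ring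

theorem symp_neg_self {n : ℕ} (b : Fin n → ℝ) (v : Fin n ⊕ Fin n → ℝ) :
    symp b (-v) v = 0 := by
  simp only [symp, Pi.neg_apply]
  exact Finset.sum_eq_zero fun i _ => by ring

theorem symp_zero_left {n : ℕ} (b : Fin n → ℝ) (v : Fin n ⊕ Fin n → ℝ) : symp b 0 v = 0 := by
  simp [symp]

theorem symp_zero_right {n : ℕ} (b : Fin n → ℝ) (v : Fin n ⊕ Fin n → ℝ) : symp b v 0 = 0 := by
  simp [symp]

instance instGroupHeis {n : ℕ} (b : Fin n → ℝ) : Group (Heis b) where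
  one := ⟨0, 0⟩
  inv q := ⟨-q.xy, -q.z⟩
  mul_assoc q q' q'' := by
    simp only [Heis.mul_eq, symp_add_left, symp_add_right]
    exact Heis.ext (add_assoc _ _ _) (by simp only; ring)
  one_mul q := by
    change (⟨0, 0⟩ : Heis b) * q = q
    rw [Heis.mul_eq]
    exact Heis.ext (zero_add _) (by simp [symp_zero_left])
  mul_one q := by
    change q * (⟨0, 0⟩ : Heis b) = q
    rw [Heis.mul_eq]
    exact Heis.ext (add_zero _) (by simp [symp_zero_right])
  inv_mul_cancel q := by
    change (⟨-q.xy, -q.z⟩ : Heis b) * q = ⟨0, 0⟩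
    rw [Heis.mul_eq]
    exact Heis.ext (neg_add_cancel _) (by simp [symp_neg_self])

/-! ### The blockwise structure group -/

/-- The indices of the `i`-th block of the composition `n = k₁ + ⋯ + k_m`. -/
abbrev Block {n : ℕ} (c : Composition n) (i : Fin c.length) : Type := {j : Fin n // c.index j = i}

/-- The inclusion of the indices of the frame `{X_j, Y_j : j in block i}` of `Hⁱ`. -/
def emb {n : ℕ} (c : Composition n) (i : Fin c.length) :
    Block c i ⊕ Block c i → Fin n ⊕ Fin n :=
  Sum.map Subtype.val Subtype.val

/-- The group `Sp(Ω) ∩ O(G)` of invertible matrices preserving the forms with the Gram matrices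
`G` and `Ω`. -/
def preservingGroup {m : Type*} [Fintype m] [DecidableEq m] (G Ω : Matrix m m ℝ) :
    Subgroup (GL m ℝ) where
  carrier := {A | A.1.transpose * G * A.1 = G ∧ A.1.transpose * Ω * A.1 = Ω}
  mul_mem' := by
    have key : ∀ (A B : GL m ℝ) (S : Matrix m m ℝ), A.1.transpose * S * A.1 = S →
        B.1.transpose * S * B.1 = S → (A * B).1.transpose * S * (A * B).1 = S := by
      intro A B S hA hB
      calc (A * B).1.transpose * S * (A * B).1
          = B.1.transpose * (A.1.transpose * S * A.1) * B.1 := by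
            simp [Matrix.transpose_mul, Matrix.mul_assoc]
        _ = S := by rw [hA, hB]
    exact fun {A B} hA hB => ⟨key A B G hA.1 hB.1, key A B Ω hA.2 hB.2⟩
  one_mem' := by simp
  inv_mem' := by
    have key : ∀ (A : GL m ℝ) (S : Matrix m m ℝ), A.1.transpose * S * A.1 = S →
        (A⁻¹).1.transpose * S * (A⁻¹).1 = S := by
      intro A S hA
      have h1 : A.1 * (A⁻¹).1 = 1 := A.mul_inv
      have h2 : (A⁻¹).1.transpose * A.1.transpose = 1 := by
        rw [← Matrix.transpose_mul, h1, Matrix.transpose_one]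
      calc (A⁻¹).1.transpose * S * (A⁻¹).1
          = (A⁻¹).1.transpose * (A.1.transpose * S * A.1) * (A⁻¹).1 := by rw [hA]
        _ = ((A⁻¹).1.transpose * A.1.transpose) * S * (A.1 * (A⁻¹).1) := by
            simp only [Matrix.mul_assoc]
        _ = S := by rw [h1, h2, one_mul, mul_one]
    exact fun {A} hA => ⟨key A G hA.1, key A Ω hA.2⟩

/-- The group `Sp(ω|Hⁱ) ∩ O(g|Hⁱ)`, in the frame `{X_j, Y_j : j in block i}` of `Hⁱ`. -/
def blockGroup {n : ℕ} (c : Composition n) (b p r : Fin n → ℝ) (i : Fin c.length) :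
    Subgroup (GL (Block c i ⊕ Block c i) ℝ) :=
  preservingGroup ((gramMetric p r).submatrix (emb c i) (emb c i))
    ((gramSymp b).submatrix (emb c i) (emb c i))

/-- The structure group `(Sp(ω|H¹) ∩ O(g|H¹)) × ⋯ × (Sp(ω|Hᵐ) ∩ O(g|Hᵐ))`. -/
abbrev StructureGroup {n : ℕ} (c : Composition n) (b p r : Fin n → ℝ) : Type :=
  ∀ i : Fin c.length, blockGroup c b p r i

open Matrix in
/-- The blockwise linear action of the structure group on the coordinates `(x, y)`. -/
def act {n : ℕ} {c : Composition n} {b p r : Fin n → ℝ} (σ : StructureGroup c b p r)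
    (v : Fin n ⊕ Fin n → ℝ) : Fin n ⊕ Fin n → ℝ
  | Sum.inl j => ((σ (c.index j)).1.1 *ᵥ (v ∘ emb c (c.index j))) (Sum.inl ⟨j, rfl⟩)
  | Sum.inr j => ((σ (c.index j)).1.1 *ᵥ (v ∘ emb c (c.index j))) (Sum.inr ⟨j, rfl⟩)

open Matrix in
theorem act_comp_emb {n : ℕ} {c : Composition n} {b p r : Fin n → ℝ} (σ : StructureGroup c b p r)
    (v : Fin n ⊕ Fin n → ℝ) (i : Fin c.length) :
    act σ v ∘ emb c i = (σ i).1.1 *ᵥ (v ∘ emb c i) := by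
  ext k
  rcases k with ⟨j, rfl⟩ | ⟨j, rfl⟩ <;> rfl

theorem ext_emb {n : ℕ} (c : Composition n) {v w : Fin n ⊕ Fin n → ℝ}
    (h : ∀ i, v ∘ emb c i = w ∘ emb c i) : v = w := by
  ext k
  rcases k with j | j
  · exact congrFun (h (c.index j)) (Sum.inl ⟨j, rfl⟩)
  · exact congrFun (h (c.index j)) (Sum.inr ⟨j, rfl⟩)

open Matrix in
theorem symp_eq_sum_block {n : ℕ} (c : Composition n) (b : Fin n → ℝ)
    (v w : Fin n ⊕ Fin n → ℝ) :
    symp b v w = ∑ i, (v ∘ emb c i) ⬝ᵥ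
      (gramSymp b).submatrix (emb c i) (emb c i) *ᵥ (w ∘ emb c i) := by
  have key : ∀ i, (gramSymp b).submatrix (emb c i) (emb c i) =
      Matrix.fromBlocks 0 (Matrix.diagonal fun j : Block c i => b j)
        (-Matrix.diagonal fun j : Block c i => b j) 0 := by
    intro i
    ext k l
    rcases k with k | k <;> rcases l with l | l <;>
      simp [gramSymp, emb, Matrix.diagonal_apply, Subtype.ext_iff]
  rw [symp, ← Equiv.sum_comp (Equiv.sigmaFiberEquiv c.index), Fintype.sum_sigma]
  refine Finset.sum_congr rfl fun i _ => ?_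
  rw [key]
  simp only [dotProduct, fromBlocks_mulVec, Fintype.sum_sum_type, Sum.elim_inl,
    Sum.elim_inr, zero_mulVec, neg_mulVec, mulVec_diagonal,
    Pi.neg_apply, Function.comp_apply, zero_add, add_zero, ← Finset.sum_add_distrib]
  refine Finset.sum_congr rfl fun j _ => ?_
  simp only [emb, Sum.map_inl, Sum.map_inr, Equiv.sigmaFiberEquiv_apply]
  ring

open Matrix in
theorem symp_act {n : ℕ} {c : Composition n} {b p r : Fin n → ℝ} (σ : StructureGroup c b p r)
    (v w : Fin n ⊕ Fin n → ℝ) : symp b (act σ v) (act σ w) = symp b v w := by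
  rw [symp_eq_sum_block c, symp_eq_sum_block c]
  refine Finset.sum_congr rfl fun i _ => ?_
  rw [act_comp_emb, act_comp_emb]
  have h := (σ i).2.2
  conv_rhs => rw [← h]
  rw [← Matrix.mulVec_mulVec, ← Matrix.mulVec_mulVec, Matrix.dotProduct_mulVec _ (_ᵀ),
    Matrix.vecMul_transpose]

theorem act_add {n : ℕ} {c : Composition n} {b p r : Fin n → ℝ} (σ : StructureGroup c b p r)
    (v w : Fin n ⊕ Fin n → ℝ) : act σ (v + w) = act σ v + act σ w := by
  refine ext_emb c fun i => ?_
  rw [act_comp_emb, show (v + w) ∘ emb c i = v ∘ emb c i + w ∘ emb c i from rfl,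
    Matrix.mulVec_add, ← act_comp_emb, ← act_comp_emb]
  rfl

theorem act_mul {n : ℕ} {c : Composition n} {b p r : Fin n → ℝ} (σ τ : StructureGroup c b p r)
    (v : Fin n ⊕ Fin n → ℝ) : act (σ * τ) v = act σ (act τ v) := by
  refine ext_emb c fun i => ?_
  rw [act_comp_emb, act_comp_emb, act_comp_emb, Matrix.mulVec_mulVec]
  rfl

theorem act_one {n : ℕ} {c : Composition n} {b p r : Fin n → ℝ}
    (v : Fin n ⊕ Fin n → ℝ) : act (1 : StructureGroup c b p r) v = v := by
  refine ext_emb c fun i => ?_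
  rw [act_comp_emb]
  exact Matrix.one_mulVec _

/-- The action of the structure group on the deformed Heisenberg group by the automorphisms
`f_σ(x, y, z) = (σ · (x, y), z)`. -/
def heisAction {n : ℕ} (c : Composition n) (b p r : Fin n → ℝ) :
    StructureGroup c b p r →* MulAut (Heis b) where
  toFun σ :=
    { toFun := fun q => ⟨act σ q.xy, q.z⟩
      invFun := fun q => ⟨act σ⁻¹ q.xy, q.z⟩
      left_inv := fun q => by
        refine Heis.ext ?_ rfl
        change act σ⁻¹ (act σ q.xy) = q.xy
        rw [← act_mul, inv_mul_cancel, act_one]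
      right_inv := fun q => by
        refine Heis.ext ?_ rfl
        change act σ (act σ⁻¹ q.xy) = q.xy
        rw [← act_mul, mul_inv_cancel, act_one]
      map_mul' := fun q q' => by simp only [Heis.mul_eq, act_add, symp_act] }
  map_one' := MulEquiv.ext fun _ => Heis.ext (act_one _) rfl
  map_mul' σ τ := MulEquiv.ext fun _ => Heis.ext (act_mul σ τ _) rfl

/-- The product topology on a semidirect product. -/
instance instTopologicalSpaceSemidirect {N G : Type*} [Group N] [Group G] [TopologicalSpace N]
    [TopologicalSpace G] (φ : G →* MulAut N) : TopologicalSpace (N ⋊[φ] G) :=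
  TopologicalSpace.induced SemidirectProduct.equivProd inferInstance

/-! ### The operator `J` and the numbers `sᵢ` -/

/-- The operator `J : H → H` with `ω(v, w) = g(J v, w)`, in the frame `X₁, …, Xₙ, Y₁, …, Yₙ`. -/
def opJ {n : ℕ} (b p r : Fin n → ℝ) : Matrix (Fin n ⊕ Fin n) (Fin n ⊕ Fin n) ℝ :=
  (gramMetric p r)⁻¹ * (gramSymp b).transpose

open Matrix in
theorem symp_eq_opJ {n : ℕ} (b p r : Fin n → ℝ) (hp : ∀ j, p j = -1 ∨ p j = 1)
    (hr : ∀ j, r j = -1 ∨ r j = 1) (v w : Fin n ⊕ Fin n → ℝ) :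
    symp b v w = metric p r (opJ b p r *ᵥ v, 0) (w, 0) := by
  have hu : IsUnit (gramMetric p r).det := by
    rw [gramMetric, det_diagonal, isUnit_iff_ne_zero, Finset.prod_ne_zero_iff]
    rintro (j | j) -
    · rcases hp j with h | h <;> simp [h]
    · rcases hr j with h | h <;> simp [h]
  have ht : (gramMetric p r)ᵀ = gramMetric p r := diagonal_transpose _
  have hm : (opJ b p r)ᵀ * gramMetric p r = gramSymp b := by
    rw [opJ, transpose_mul, transpose_transpose, transpose_nonsing_inv, ht, Matrix.mul_assoc,
      nonsing_inv_mul _ hu, Matrix.mul_one]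
  rw [metric_eq, symp_eq, ← hm, ← mulVec_mulVec, dotProduct_mulVec, vecMul_transpose]

/-- The subspace `Ĥ` of `H` spanned by the (two-dimensional real) eigenspaces of `J` for the purely
imaginary eigenvalues `±√-1 β`, `β > 0`.  As `J` is diagonalizable over `ℂ`, these span the kernel
of `J² + β²`. -/
def hatH {n : ℕ} (b p r : Fin n → ℝ) : Submodule ℝ (Fin n ⊕ Fin n → ℝ) :=
  ⨆ (β : ℝ) (_ : 0 < β),
    Module.End.eigenspace (Matrix.toLin' (opJ b p r * opJ b p r)) (-β ^ 2)

/-- The subspace `Hⁱ = span {X_j, Y_j : j in block i}` of `H`. -/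
def blockSpace {n : ℕ} (c : Composition n) (i : Fin c.length) :
    Submodule ℝ (Fin n ⊕ Fin n → ℝ) :=
  Submodule.span ℝ (Set.range fun k => Pi.single (emb c i k) (1 : ℝ))

/-- The number `sᵢ = ½ rk (Hⁱ ∩ Ĥ)`. -/
def halfRank {n : ℕ} (c : Composition n) (b p r : Fin n → ℝ) (i : Fin c.length) : ℝ :=
  (Module.finrank ℝ (blockSpace c i ⊓ hatH b p r : Submodule ℝ (Fin n ⊕ Fin n → ℝ)) : ℝ) / 2

end

end SubPseudoRiem

namespace SubPseudoRiem

open Matrix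

/-! ### Matrices preserving the metric and the symplectic form -/

/-! Every isometry `f` is affine. Write `H = ker α` with `α = dz + ½ ω((x,y), ·)`. Since `f`
preserves `H`, `f^*α = μ α` for a function `μ`. Taking exterior derivatives and restricting to `H`
shows that the matrix `A` of `f_*` in the frame scales `ω` by `μ`. It also preserves `g`, so a
comparison of determinants gives `μ² = 1`, and `μ` is locally constant. Then `f_*` maps the Reeb
line to itself, and the `(x,y)`-part of `f` has a differential that preserves the constant form `g`.
As for isometries of a flat metric, the symmetry of second derivatives forces `A` to be constant.
The `z`-part is then dictated by `α`. This is `IsIsometry.exists_eq`.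

Both orientations together force `μ = 1`. Conversely, a left translation composed with a matrix
preserving `g` and `ω` is an oriented isometry (`isIsometry_and_orientation_of_affine`). Such a
matrix commutes with `J`, hence with the diagonal matrix `J²`, whose entries `-p_j r_j b_j²`
determine `b_j`. It is therefore block diagonal, so that `Sp(ω) ∩ O(g)` is the product over the
blocks (`exists_act_eq`). The group isomorphism is a homeomorphism because the translation and the
matrix can be read off from finitely many values of `f` (`nonempty_continuousMulEquiv`).

For the dimension, a one-parameter group consists of squares, so its members have `μ = 1`, and
differentiating it yields a translation field plus a linear field in the Lie algebra of `Sp(ω) ∩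
O(g)`. Both kinds of field integrate to isometries (`span_infinitesimalIsometries`). That Lie
algebra has one free coordinate for each pair of indices with equal `b` and equal sign `p r`
(`lieAlgEquiv`). In block `i` the sign `+1` occurs `s_i` times, because `Ĥ` is spanned by the `X_j,
Y_j` with `p_j r_j = 1` (`halfRank_eq`). Counting the pairs gives `s_i² + (k_i - s_i)²`. -/

theorem transpose_mul_mul_eq_iff {m : Type*} [Fintype m] [DecidableEq m] (A S T : Matrix m m ℝ) :
    Aᵀ * S * A = T ↔ ∀ u v, (A *ᵥ u) ⬝ᵥ S *ᵥ (A *ᵥ v) = u ⬝ᵥ T *ᵥ v := by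
  have key : ∀ u v, (A *ᵥ u) ⬝ᵥ S *ᵥ (A *ᵥ v) = u ⬝ᵥ (Aᵀ * S * A) *ᵥ v := by
    intro u v
    rw [← Matrix.mulVec_mulVec, ← Matrix.mulVec_mulVec, Matrix.dotProduct_mulVec _ (_ᵀ),
      Matrix.vecMul_transpose]
  constructor
  · rintro rfl u v
    exact key u v
  · intro h
    ext i j
    have := (key (Pi.single i 1) (Pi.single j 1)).symm.trans (h (Pi.single i 1) (Pi.single j 1))
    simpa using this

theorem gramMetric_mul_self {n : ℕ} {p r : Fin n → ℝ} (hp : ∀ j, p j = -1 ∨ p j = 1)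
    (hr : ∀ j, r j = -1 ∨ r j = 1) : gramMetric p r * gramMetric p r = 1 := by
  rw [gramMetric, diagonal_mul_diagonal, ← diagonal_one]
  congr 1
  ext (j | j)
  · rcases hp j with h | h <;> simp [h]
  · rcases hr j with h | h <;> simp [h]

theorem isUnit_det_gramMetric {n : ℕ} {p r : Fin n → ℝ} (hp : ∀ j, p j = -1 ∨ p j = 1)
    (hr : ∀ j, r j = -1 ∨ r j = 1) : IsUnit (gramMetric p r).det :=
  IsUnit.of_mul_eq_one _ (by rw [← det_mul, gramMetric_mul_self hp hr, det_one])

/-- Rescaling the `y`-coordinates by `b` turns `ω` into the standard symplectic form, which makes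
the results on `symplecticGroup` available. The sign comes from the convention for `J`. -/
theorem gramSymp_eq {n : ℕ} (b : Fin n → ℝ) :
    gramSymp b = (fromBlocks 1 0 0 (diagonal b))ᵀ * (-J (Fin n) ℝ) *
      fromBlocks 1 0 0 (diagonal b) := by
  simp [gramSymp, J, fromBlocks_multiply, fromBlocks_transpose, fromBlocks_neg]

theorem isUnit_det_fromBlocks_diagonal {n : ℕ} {b : Fin n → ℝ} (hb : ∀ j, 0 < b j) :
    IsUnit (fromBlocks 1 0 0 (diagonal b) : Matrix (Fin n ⊕ Fin n) (Fin n ⊕ Fin n) ℝ).det := by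
  rw [det_fromBlocks_zero₂₁, det_one, one_mul, det_diagonal, isUnit_iff_ne_zero,
    Finset.prod_ne_zero_iff]
  exact fun j _ => (hb j).ne'

theorem isUnit_det_gramSymp {n : ℕ} {b : Fin n → ℝ} (hb : ∀ j, 0 < b j) :
    IsUnit (gramSymp b).det := by
  have h := isUnit_det_fromBlocks_diagonal hb
  rw [gramSymp_eq, det_mul, det_mul, det_transpose, det_neg]
  exact (h.mul (((isUnit_one.neg).pow _).mul (isUnit_det_J _ _))).mul h

theorem det_eq_one_of_preserves_gramSymp {n : ℕ} {b : Fin n → ℝ} (hb : ∀ j, 0 < b j)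
    {A : Matrix (Fin n ⊕ Fin n) (Fin n ⊕ Fin n) ℝ} (hA : Aᵀ * gramSymp b * A = gramSymp b) :
    A.det = 1 := by
  have hT := isUnit_det_fromBlocks_diagonal hb
  rw [gramSymp_eq] at hA
  set T : Matrix (Fin n ⊕ Fin n) (Fin n ⊕ Fin n) ℝ := fromBlocks 1 0 0 (diagonal b)
  have h1 : T * T⁻¹ = 1 := mul_nonsing_inv T hT
  have h2 : (T⁻¹)ᵀ * Tᵀ = 1 := by rw [← transpose_mul, h1, transpose_one]
  -- Conjugation by the rescaling does not change the determinant, and symplectic matrices have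
  -- determinant one.
  have key : (T * A * T⁻¹) ∈ symplecticGroup (Fin n) ℝ := by
    rw [SymplecticGroup.mem_iff']
    have : (T⁻¹)ᵀ * (Aᵀ * (Tᵀ * (-J (Fin n) ℝ) * T) * A) * T⁻¹ = -J (Fin n) ℝ := by
      rw [hA]
      calc _ = ((T⁻¹)ᵀ * Tᵀ) * (-J (Fin n) ℝ) * (T * T⁻¹) := by simp only [Matrix.mul_assoc]
        _ = _ := by rw [h1, h2, one_mul, mul_one]
    rw [transpose_mul, transpose_mul, ← neg_inj, ← this]
    simp only [Matrix.mul_assoc, Matrix.neg_mul, Matrix.mul_neg]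
  have := SymplecticGroup.det_eq_one key
  rwa [det_mul, det_mul, mul_comm T.det, mul_assoc, ← det_mul, h1, det_one, mul_one] at this

theorem isUnit_det_of_preserves {m : Type*} [Fintype m] [DecidableEq m] {A S : Matrix m m ℝ}
    (hS : IsUnit S.det) (hA : Aᵀ * S * A = S) : IsUnit A.det := by
  rw [← hA, det_mul] at hS
  exact isUnit_of_mul_isUnit_right hS

/-- The metric gives `(det A)² = 1` and the symplectic form gives `(det A)² = μ^{2n}`. The exponent
is nonzero because `n ≥ 1`. -/
theorem sq_eq_one_of_similitude {n : ℕ} (hn : 1 ≤ n) {b p r : Fin n → ℝ} (hb : ∀ j, 0 < b j)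
    (hp : ∀ j, p j = -1 ∨ p j = 1) (hr : ∀ j, r j = -1 ∨ r j = 1)
    {A : Matrix (Fin n ⊕ Fin n) (Fin n ⊕ Fin n) ℝ} {μ : ℝ}
    (hG : Aᵀ * gramMetric p r * A = gramMetric p r)
    (hΩ : Aᵀ * gramSymp b * A = μ • gramSymp b) : μ ^ 2 = 1 := by
  have h1 := congrArg det hG
  have h2 := congrArg det hΩ
  rw [det_mul, det_mul, det_transpose] at h1 h2
  rw [det_smul, Fintype.card_sum, Fintype.card_fin, ← two_mul, pow_mul] at h2
  have hG0 := (isUnit_det_gramMetric hp hr).ne_zero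
  have hΩ0 := (isUnit_det_gramSymp hb).ne_zero
  have h3 : A.det * A.det = 1 := mul_right_cancel₀ hG0 (by linear_combination h1)
  have h4 : (μ ^ 2) ^ n = 1 := mul_right_cancel₀ hΩ0 (by
    linear_combination -h2 + (gramSymp b).det * h3)
  exact (pow_eq_one_iff_of_nonneg (sq_nonneg μ) (by omega)).mp h4

/-- The diagonal entries of the square of `J`. -/
def sqJ {n : ℕ} (b p r : Fin n → ℝ) : Fin n ⊕ Fin n → ℝ :=
  Sum.elim (fun j => -(p j * r j * b j ^ 2)) (fun j => -(p j * r j * b j ^ 2))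

theorem opJ_eq {n : ℕ} {b p r : Fin n → ℝ} (hp : ∀ j, p j = -1 ∨ p j = 1)
    (hr : ∀ j, r j = -1 ∨ r j = 1) : opJ b p r = gramMetric p r * (gramSymp b)ᵀ := by
  rw [opJ, inv_eq_right_inv (gramMetric_mul_self hp hr)]

theorem opJ_mul_opJ {n : ℕ} {b p r : Fin n → ℝ} (hp : ∀ j, p j = -1 ∨ p j = 1)
    (hr : ∀ j, r j = -1 ∨ r j = 1) : opJ b p r * opJ b p r = diagonal (sqJ b p r) := by
  have h1 : gramMetric p r = fromBlocks (diagonal p) 0 0 (diagonal r) :=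
    (fromBlocks_diagonal p r).symm
  rw [opJ_eq hp hr, h1, gramSymp, sqJ, ← fromBlocks_diagonal]
  simp only [fromBlocks_transpose, fromBlocks_multiply, transpose_zero,
    diagonal_transpose, Matrix.mul_zero, Matrix.zero_mul, add_zero, zero_add,
    diagonal_mul_diagonal, diagonal_neg]
  congr 2 <;> ext j <;> ring

/-- `J` is built from `g` and `ω` alone, so a matrix that preserves both conjugates `J` to itself.
-/
theorem commute_opJ {n : ℕ} {b p r : Fin n → ℝ} (hp : ∀ j, p j = -1 ∨ p j = 1)
    (hr : ∀ j, r j = -1 ∨ r j = 1) {A : Matrix (Fin n ⊕ Fin n) (Fin n ⊕ Fin n) ℝ}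
    (hG : Aᵀ * gramMetric p r * A = gramMetric p r)
    (hΩ : Aᵀ * gramSymp b * A = gramSymp b) : Commute A (opJ b p r) := by
  have hA := isUnit_det_of_preserves (isUnit_det_gramMetric hp hr) hG
  have hGG := gramMetric_mul_self hp hr
  have hΩ' : Aᵀ * (gramSymp b)ᵀ * A = (gramSymp b)ᵀ := by
    conv_rhs => rw [← hΩ]
    simp only [transpose_mul, transpose_transpose, Matrix.mul_assoc]
  have h1 : Aᵀ * gramMetric p r = gramMetric p r * A⁻¹ := by
    conv_rhs => rw [← hG]
    rw [Matrix.mul_assoc, mul_nonsing_inv A hA, Matrix.mul_one]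
  have h2 : gramMetric p r * Aᵀ = A⁻¹ * gramMetric p r := by
    calc gramMetric p r * Aᵀ = gramMetric p r * (Aᵀ * gramMetric p r) * gramMetric p r := by
          rw [Matrix.mul_assoc, Matrix.mul_assoc, hGG, Matrix.mul_one]
      _ = A⁻¹ * gramMetric p r := by rw [h1, ← Matrix.mul_assoc, hGG, Matrix.one_mul]
  have h3 : opJ b p r = A⁻¹ * opJ b p r * A := by
    conv_lhs => rw [opJ_eq hp hr, ← hΩ', ← Matrix.mul_assoc, ← Matrix.mul_assoc, h2]
    rw [opJ_eq hp hr]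
    simp only [Matrix.mul_assoc]
  change A * opJ b p r = opJ b p r * A
  conv_lhs => rw [h3]
  rw [← Matrix.mul_assoc, ← Matrix.mul_assoc, mul_nonsing_inv A hA, Matrix.one_mul]

/-- `A` commutes with the diagonal matrix `J²`, hence preserves its eigenspaces. -/
theorem apply_eq_zero_of_sqJ_ne {n : ℕ} {b p r : Fin n → ℝ} (hp : ∀ j, p j = -1 ∨ p j = 1)
    (hr : ∀ j, r j = -1 ∨ r j = 1) {A : Matrix (Fin n ⊕ Fin n) (Fin n ⊕ Fin n) ℝ}
    (hG : Aᵀ * gramMetric p r * A = gramMetric p r)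
    (hΩ : Aᵀ * gramSymp b * A = gramSymp b) {k l : Fin n ⊕ Fin n}
    (hkl : sqJ b p r k ≠ sqJ b p r l) : A k l = 0 := by
  have h := commute_opJ hp hr hG hΩ
  have h2 : A * (opJ b p r * opJ b p r) = (opJ b p r * opJ b p r) * A := h.mul_right h
  rw [opJ_mul_opJ hp hr] at h2
  have h3 := congrFun (congrFun h2 k) l
  rw [mul_diagonal, diagonal_mul] at h3
  by_contra h0
  exact hkl (mul_right_cancel₀ h0 (by linear_combination -h3))

/-- The absolute value of `p r b²` is `b²` with `b > 0`, and its sign is `p r`. -/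
theorem sqJ_eq_iff {n : ℕ} {b p r : Fin n → ℝ} (hb : ∀ j, 0 < b j)
    (hp : ∀ j, p j = -1 ∨ p j = 1) (hr : ∀ j, r j = -1 ∨ r j = 1) (i j : Fin n) :
    p i * r i * b i ^ 2 = p j * r j * b j ^ 2 ↔ b i = b j ∧ p i * r i = p j * r j := by
  have hi := hb i
  have hj := hb j
  constructor
  · intro h
    have key : ∀ j, p j * r j = -1 ∨ p j * r j = 1 := by
      intro j
      rcases hp j with h | h <;> rcases hr j with h' | h' <;> simp [h, h']
    rcases key i with h1 | h1 <;> rcases key j with h2 | h2 <;> rw [h1, h2] at h ⊢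
    · refine ⟨?_, rfl⟩
      exact (pow_left_inj₀ hi.le hj.le two_ne_zero).mp (by linarith)
    · nlinarith
    · nlinarith
    · refine ⟨?_, rfl⟩
      exact (pow_left_inj₀ hi.le hj.le two_ne_zero).mp (by linarith)
  · rintro ⟨h1, h2⟩
    rw [h1, h2]


/-! ### The contact form -/

/-- The bilinear form with Gram matrix `S`. -/
noncomputable def gramForm {m : Type*} [Fintype m] [DecidableEq m] (S : Matrix m m ℝ) :
    (m → ℝ) →L[ℝ] (m → ℝ) →L[ℝ] ℝ :=
  (Matrix.toLinearMap₂' ℝ S).toContinuousBilinearMap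

theorem gramForm_apply {m : Type*} [Fintype m] [DecidableEq m] (S : Matrix m m ℝ) (u v : m → ℝ) :
    gramForm S u v = u ⬝ᵥ S *ᵥ v :=
  Matrix.toLinearMap₂'_apply' _ _ _

theorem symp_eq_gramForm {n : ℕ} (b : Fin n → ℝ) (v w : Fin n ⊕ Fin n → ℝ) :
    symp b v w = gramForm (gramSymp b) v w := by
  rw [symp_eq, gramForm_apply]

theorem metric_eq_gramForm {n : ℕ} (p r : Fin n → ℝ) (v w : Coord n) :
    metric p r v w = gramForm (gramMetric p r) v.1 w.1 := by
  rw [metric_eq, gramForm_apply]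

theorem symp_swap {n : ℕ} (b : Fin n → ℝ) (v w : Fin n ⊕ Fin n → ℝ) :
    symp b w v = -symp b v w := by
  simp only [symp, ← Finset.sum_neg_distrib]
  exact Finset.sum_congr rfl fun i _ => by ring

theorem symp_self {n : ℕ} (b : Fin n → ℝ) (v : Fin n ⊕ Fin n → ℝ) : symp b v v = 0 := by
  linarith [symp_swap b v v]

theorem metric_swap {n : ℕ} (p r : Fin n → ℝ) (v w : Coord n) :
    metric p r w v = metric p r v w := by
  simp only [metric]
  exact Finset.sum_congr rfl fun i _ => by ring

/-- The contact form whose kernel is `H`. -/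
noncomputable def contactForm {n : ℕ} (b : Fin n → ℝ) (q : Coord n) : Coord n →ₗ[ℝ] ℝ :=
  LinearMap.snd ℝ _ _ +
    (1 / 2 : ℝ) • (gramForm (gramSymp b) q.1).toLinearMap ∘ₗ LinearMap.fst ℝ _ _

theorem contactForm_apply {n : ℕ} (b : Fin n → ℝ) (q v : Coord n) :
    contactForm b q v = v.2 + 1 / 2 * symp b q.1 v.1 := by
  rw [symp_eq_gramForm]
  rfl

theorem frame_eq {n : ℕ} (b : Fin n → ℝ) (k : Fin n ⊕ Fin n) (q : Coord n) :
    frame b k q = (Pi.single k 1, -(1 / 2 * symp b q.1 (Pi.single k 1))) := by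
  rcases k with k | k <;> simp [frame, symp, Pi.single_apply] <;> ring

/-- A vector in the kernel of the contact form is determined by its `(x,y)`-part, whose entries are
its frame coefficients. This turns the span into one linear equation, which can be differentiated in
`q`. -/
theorem mem_dist_iff {n : ℕ} {b : Fin n → ℝ} {q v : Coord n} :
    v ∈ dist b q ↔ contactForm b q v = 0 := by
  constructor
  · intro h
    have : dist b q ≤ LinearMap.ker (contactForm b q) := by
      refine Submodule.span_le.mpr ?_
      rintro _ ⟨k, rfl⟩
      change contactForm b q (frame b k q) = 0
      rw [frame_eq, contactForm_apply]
      ring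
    exact this h
  · intro h
    have h2 : v = ∑ k, v.1 k • frame b k q := by
      have h3 : (∑ k, v.1 k • frame b k q).1 = v.1 := by
        rw [Prod.fst_sum]
        simp only [frame_eq, Prod.smul_mk]
        exact (pi_eq_sum_univ' v.1).symm
      refine Prod.ext h3.symm ?_
      have h4 : contactForm b q (∑ k, v.1 k • frame b k q) = 0 := by
        rw [map_sum]
        refine Finset.sum_eq_zero fun k _ => ?_
        rw [map_smul, frame_eq, contactForm_apply]
        simp
      rw [contactForm_apply, h3] at h4
      rw [contactForm_apply] at h
      linarith
    rw [h2]
    exact Submodule.sum_mem _ fun k _ => Submodule.smul_mem _ _ (Submodule.subset_span ⟨k, rfl⟩)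

/-- The horizontal lift of a vector with given coefficients in the frame. -/
noncomputable def lift {n : ℕ} (b : Fin n → ℝ) (q : Coord n) :
    (Fin n ⊕ Fin n → ℝ) →ₗ[ℝ] Coord n :=
  LinearMap.prod LinearMap.id (-((1 / 2 : ℝ) • (gramForm (gramSymp b) q.1).toLinearMap))

theorem lift_apply {n : ℕ} (b : Fin n → ℝ) (q : Coord n) (u : Fin n ⊕ Fin n → ℝ) :
    lift b q u = (u, -(1 / 2 * symp b q.1 u)) := by
  rw [symp_eq_gramForm]
  rfl

theorem contactForm_lift {n : ℕ} (b : Fin n → ℝ) (q : Coord n) (u : Fin n ⊕ Fin n → ℝ) :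
    contactForm b q (lift b q u) = 0 := by
  rw [lift_apply, contactForm_apply]
  ring

/-- The tangent space splits into `H` and the line of the Reeb field `∂_z`. -/
theorem eq_lift_add {n : ℕ} (b : Fin n → ℝ) (q v : Coord n) :
    v = lift b q v.1 + contactForm b q v • ((0, 1) : Coord n) := by
  rw [lift_apply, contactForm_apply]
  refine Prod.ext (by simp) ?_
  simp

theorem eq_add_of_hasFDerivAt {E F : Type*} [NormedAddCommGroup E] [NormedSpace ℝ E]
    [NormedAddCommGroup F] [NormedSpace ℝ F] {g : E → F} {L : E →L[ℝ] F}
    (h : ∀ q, HasFDerivAt g L q) (q : E) : g q = g 0 + L q := by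
  have h0 : ∀ q, HasFDerivAt (fun q => g q - L q) (0 : E →L[ℝ] F) q := fun q => by
    have h1 := (h q).sub (L.hasFDerivAt (x := q))
    rw [sub_self] at h1
    exact h1
  have := is_const_of_fderiv_eq_zero (𝕜 := ℝ) (fun q => (h0 q).differentiableAt)
    (fun q => (h0 q).fderiv) q 0
  rw [map_zero, sub_zero] at this
  rw [← this, sub_add_cancel]


/-! ### Classification of the isometries -/

/-- The product rule, with the derivative kept abstract because only its values are needed. -/
theorem hasFDerivAt_gramForm {m E : Type*} [Fintype m] [DecidableEq m] [NormedAddCommGroup E]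
    [NormedSpace ℝ E] (S : Matrix m m ℝ) {g h : E → m → ℝ} {g' h' : E →L[ℝ] m → ℝ} {q : E}
    (hg : HasFDerivAt g g' q) (hh : HasFDerivAt h h' q) :
    ∃ L : E →L[ℝ] ℝ, HasFDerivAt (fun q => gramForm S (g q) (h q)) L q ∧
      ∀ w, L w = gramForm S (g' w) (h q) + gramForm S (g q) (h' w) := by
  refine ⟨_, (gramForm S).hasFDerivAt_of_bilinear hg hh, fun w => ?_⟩
  simp [add_comm]

theorem eq_zero_of_forall_dotProduct {m : Type*} [Fintype m] [DecidableEq m] {A S : Matrix m m ℝ}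
    (hS : IsUnit S.det) (hA : IsUnit A.det) {x : m → ℝ}
    (h : ∀ u, x ⬝ᵥ S *ᵥ (A *ᵥ u) = 0) : x = 0 := by
  have hu : IsUnit (S * A).det := by rw [det_mul]; exact hS.mul hA
  refine dotProduct_eq_zero _ fun w => ?_
  have := h ((S * A)⁻¹ *ᵥ w)
  rwa [Matrix.mulVec_mulVec, Matrix.mulVec_mulVec, mul_nonsing_inv _ hu, Matrix.one_mulVec] at this

/-- A trilinear form which is symmetric in its first two and antisymmetric in its last two arguments
vanishes. -/
theorem eq_zero_of_symm_of_antisymm {V : Type*} (T : V → V → V → ℝ)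
    (hs : ∀ u v w, T u v w = T v u w) (ha : ∀ u v w, T u v w = -T u w v) (u v w : V) :
    T u v w = 0 := by
  -- Alternating the two symmetries six times returns to `T u v w` after three sign changes.
  have h1 := ha u v w
  have h2 := hs u w v
  have h3 := ha w u v
  have h4 := hs w v u
  have h5 := ha v w u
  have h6 := hs v u w
  linarith

/-- The rigidity statement: contact geometry makes the Reeb line invariant, and what remains is an
isometry of a flat metric in `(x,y)`. The case `μ = -1` is kept, since no orientation is assumed. -/
theorem IsIsometry.exists_eq {n : ℕ} (hn : 1 ≤ n) {b p r : Fin n → ℝ} (hb : ∀ j, 0 < b j)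
    (hp : ∀ j, p j = -1 ∨ p j = 1) (hr : ∀ j, r j = -1 ∨ r j = 1) {f : Equiv.Perm (Coord n)}
    (hf : IsIsometry b p r f) :
    ∃ (A : Matrix (Fin n ⊕ Fin n) (Fin n ⊕ Fin n) ℝ) (μ : ℝ),
      Aᵀ * gramMetric p r * A = gramMetric p r ∧ Aᵀ * gramSymp b * A = μ • gramSymp b ∧
      (μ = 1 ∨ μ = -1) ∧ ∀ q, f q = ((f 0).1 + A *ᵥ q.1,
        (f 0).2 + μ * q.2 - 1 / 2 * symp b (f 0).1 (A *ᵥ q.1)) := by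
  -- first and second derivatives
  set D : Coord n → Coord n →L[ℝ] Coord n := fderiv ℝ f with hDdef
  set D2 := fderiv ℝ D with hD2def
  have hD : ∀ q, HasFDerivAt f (D q) q := fun q =>
    (hf.smooth.differentiable (by simp) q).hasFDerivAt
  have hDs : ContDiff ℝ ∞ D := hf.smooth.fderiv_right (by simp)
  have hD2 : ∀ q, HasFDerivAt D (D2 q) q := fun q =>
    (hDs.differentiable (by simp) q).hasFDerivAt
  have hsym : ∀ q u v, D2 q u v = D2 q v u := fun q u v =>
    (hf.smooth.contDiffAt (x := q)).isSymmSndFDerivAt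
      (by simpa using WithTop.coe_le_coe.mpr (le_top : (2 : ℕ∞) ≤ ⊤)) u v
  have hD2v : ∀ q v, HasFDerivAt (fun q => D q v) ((D2 q).flip v) q := fun q v =>
    (hD2 q).clm_apply (hasFDerivAt_const v q) |>.congr_fderiv (by ext <;> simp)
  have hf1 : ∀ q, HasFDerivAt (fun q => (f q).1)
      ((ContinuousLinearMap.fst ℝ (Fin n ⊕ Fin n → ℝ) ℝ).comp (D q)) q := fun q => (hD q).fst
  have hDv1 : ∀ q v, HasFDerivAt (fun q => (D q v).1)
      ((ContinuousLinearMap.fst ℝ (Fin n ⊕ Fin n → ℝ) ℝ).comp ((D2 q).flip v)) q :=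
    fun q v => (hD2v q v).fst
  -- the conformal factor
  set μ : Coord n → ℝ := fun q => contactForm b (f q) (D q (0, 1)) with hμ
  have hα : ∀ q v, contactForm b (f q) (D q v) = μ q * contactForm b q v := by
    intro q v
    conv_lhs => rw [eq_lift_add b q v]
    have h0 : contactForm b (f q) (D q (lift b q v.1)) = 0 :=
      mem_dist_iff.mp (hf.map_mem (mem_dist_iff.mpr (contactForm_lift b q v.1)))
    rw [map_add, map_add, h0, map_smul, map_smul, zero_add, smul_eq_mul, mul_comm]
  have hθ : ∀ q v, ∃ L : Coord n →L[ℝ] ℝ,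
      HasFDerivAt (fun q => contactForm b (f q) (D q v)) L q ∧
      ∀ w, L w = (D2 q w v).2 + 1 / 2 * (symp b (D q w).1 (D q v).1 +
        symp b (f q).1 (D2 q w v).1) := by
    intro q v
    obtain ⟨L, hL, hL'⟩ := hasFDerivAt_gramForm (gramSymp b) (hf1 q) (hDv1 q v)
    refine ⟨_, ((hD2v q v).snd.add (hL.const_mul (1 / 2))).congr_of_eventuallyEq
      (Filter.Eventually.of_forall fun q => ?_), fun w => ?_⟩
    · beta_reduce
      rw [contactForm_apply, symp_eq_gramForm]
      rfl
    · simp only [symp_eq_gramForm]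
      simp [hL']
  have hμd : ∀ q, HasFDerivAt μ (fderiv ℝ μ q) q := fun q => by
    obtain ⟨L, hL, -⟩ := hθ q (0, 1)
    exact hL.differentiableAt.hasFDerivAt
  -- The identity `f^*α = μ α` on a constant vector `v`, differentiated in the direction `w`.
  have hext : ∀ q v w, (D2 q w v).2 + 1 / 2 * (symp b (D q w).1 (D q v).1 +
        symp b (f q).1 (D2 q w v).1) =
      fderiv ℝ μ q w * contactForm b q v + μ q * (1 / 2 * symp b w.1 v.1) := by
    intro q v w
    obtain ⟨L, hL, hL'⟩ := hθ q v
    obtain ⟨K, hK, hK'⟩ := hasFDerivAt_gramForm (gramSymp b) (hasFDerivAt_fst (𝕜 := ℝ) (p := q))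
      (hasFDerivAt_const v.1 q)
    have hc : HasFDerivAt (fun q => contactForm b q v) ((1 / 2 : ℝ) • K) q := by
      refine ((hasFDerivAt_const v.2 q).add (hK.const_mul (1 / 2))).congr_of_eventuallyEq
        (Filter.Eventually.of_forall fun q => ?_) |>.congr_fderiv (zero_add _)
      rw [contactForm_apply, symp_eq_gramForm]
      rfl
    have hprod := (hμd q).mul hc
    have heq : (fun q => contactForm b (f q) (D q v)) = μ * fun q => contactForm b q v :=
      funext fun q => hα q v
    rw [heq] at hL
    have := DFunLike.congr_fun (hL.unique hprod) w
    rw [hL'] at this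
    rw [this]
    simp [hK', symp_eq_gramForm]
    ring
  -- Antisymmetrizing in `v` and `w` cancels the second derivatives of `f`. The result is `f^*dα =
  -- dμ ∧ α + μ dα`.
  have hext2 : ∀ q v w, symp b (D q w).1 (D q v).1 = μ q * symp b w.1 v.1 +
      fderiv ℝ μ q w * contactForm b q v - fderiv ℝ μ q v * contactForm b q w := by
    intro q v w
    have h1 := hext q v w
    have h2 := hext q w v
    rw [hsym q v w, symp_swap b (D q w).1 (D q v).1, symp_swap b w.1 v.1] at h2
    linarith
  -- the matrix of the differential
  set A : Coord n → Matrix (Fin n ⊕ Fin n) (Fin n ⊕ Fin n) ℝ := fun q => LinearMap.toMatrix'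
    (LinearMap.fst ℝ _ ℝ ∘ₗ (D q).toLinearMap ∘ₗ lift b q) with hAdef
  have hA : ∀ q u, A q *ᵥ u = (D q (lift b q u)).1 := fun q u => by
    rw [hAdef]
    exact LinearMap.toMatrix'_mulVec _ _
  have hG : ∀ q, (A q)ᵀ * gramMetric p r * A q = gramMetric p r := fun q => by
    rw [transpose_mul_mul_eq_iff]
    intro u v
    have := hf.map_metric q _ (mem_dist_iff.mpr (contactForm_lift b q u)) _
      (mem_dist_iff.mpr (contactForm_lift b q v))
    rw [metric_eq, metric_eq] at this
    rw [hA, hA, this, lift_apply, lift_apply]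
  have hΩ : ∀ q, (A q)ᵀ * gramSymp b * A q = μ q • gramSymp b := fun q => by
    rw [transpose_mul_mul_eq_iff]
    intro u v
    rw [hA, hA, ← symp_eq, hext2, contactForm_lift, contactForm_lift, mul_zero, mul_zero, sub_zero,
      add_zero, lift_apply, lift_apply, smul_mulVec, dotProduct_smul, symp_eq, smul_eq_mul]
  have hAu : ∀ q, IsUnit (A q).det := fun q =>
    isUnit_det_of_preserves (isUnit_det_gramMetric hp hr) (hG q)
  have hμsq : ∀ q, μ q ^ 2 = 1 := fun q => sq_eq_one_of_similitude hn hb hp hr (hG q) (hΩ q)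
  -- Differentiating `μ² = 1` gives `2 μ dμ = 0`, and `μ` has no zeros.
  have hμ0 : ∀ q, fderiv ℝ μ q = 0 := by
    intro q
    have h1 := (hμd q).mul (hμd q)
    have h2 : μ * μ = fun _ => (1 : ℝ) := funext fun q => by
      rw [← hμsq q, sq]
      rfl
    rw [h2] at h1
    have h3 := h1.unique (hasFDerivAt_const 1 q)
    have h4 : μ q ≠ 0 := fun h => by simpa [h] using hμsq q
    refine ContinuousLinearMap.ext fun w => ?_
    have h5 := DFunLike.congr_fun h3 w
    simp only [_root_.add_apply, _root_.smul_apply, _root_.zero_apply, smul_eq_mul] at h5 ⊢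
    exact (mul_eq_zero.mp (show μ q * fderiv ℝ μ q w = 0 by linarith)).resolve_left h4
  have hμc : ∀ q, μ q = μ 0 := fun q =>
    is_const_of_fderiv_eq_zero (𝕜 := ℝ) (fun q => (hμd q).differentiableAt) hμ0 q 0
  -- the Reeb field is preserved up to sign
  have hZ : ∀ q, (D q (0, 1)).1 = 0 := by
    intro q
    -- With `dμ = 0` the image of the Reeb field is `ω`-orthogonal to every `A u`, and `ω` is
    -- nondegenerate.
    refine eq_zero_of_forall_dotProduct (isUnit_det_gramSymp hb) (hAu q) fun u => ?_
    rw [hA, ← symp_eq, hext2, hμ0]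
    simp [symp_zero_left]
  have hD1 : ∀ q v, (D q v).1 = A q *ᵥ v.1 := by
    intro q v
    conv_lhs => rw [eq_lift_add b q v]
    rw [map_add, map_smul, Prod.fst_add, Prod.smul_fst, hZ, smul_zero, add_zero, hA]
  -- the horizontal part of the differential is constant
  have hflat : ∀ q u v, (D2 q u v).1 = 0 := by
    intro q u v
    refine eq_zero_of_forall_dotProduct (isUnit_det_gramMetric hp hr) (hAu q) fun x => ?_
    -- The form `g(D²f(u,v), Df(w))` is symmetric in `u, v`. It is antisymmetric in `v, w` because
    -- `g(Df(v), Df(w))` does not depend on the point.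
    have key := eq_zero_of_symm_of_antisymm
      (fun u v w : Coord n => gramForm (gramMetric p r) (D2 q u v).1 (D q w).1)
      (fun u v w => by simp only [hsym q u v]) (fun u v w => ?_) u v (x, 0)
    · rw [← gramForm_apply]
      simpa only [hD1] using key
    · obtain ⟨L, hL, hL'⟩ := hasFDerivAt_gramForm (gramMetric p r) (hDv1 q v) (hDv1 q w)
      have hc : (fun q => gramForm (gramMetric p r) (D q v).1 (D q w).1) =
          fun _ => gramForm (gramMetric p r) v.1 w.1 := by
        funext q
        rw [hD1, hD1, gramForm_apply, gramForm_apply]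
        exact (transpose_mul_mul_eq_iff _ _ _).mp (hG q) _ _
      rw [hc] at hL
      have h1 := DFunLike.congr_fun (hL.unique (hasFDerivAt_const _ q)) u
      rw [hL'] at h1
      have h2 : gramForm (gramMetric p r) (D q v).1 (D2 q u w).1 =
          gramForm (gramMetric p r) (D2 q u w).1 (D q v).1 := by
        have := metric_swap p r (D2 q u w) (D q v)
        rwa [metric_eq_gramForm, metric_eq_gramForm] at this
      have h3 : gramForm (gramMetric p r) (D2 q u v).1 (D q w).1 +
          gramForm (gramMetric p r) (D q v).1 (D2 q u w).1 = 0 := h1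
      linarith
  have hAc : ∀ q u, A q *ᵥ u = A 0 *ᵥ u := by
    intro q u
    have := is_const_of_fderiv_eq_zero (𝕜 := ℝ) (f := fun q => (D q (u, 0)).1)
      (fun q => (hDv1 q (u, 0)).differentiableAt)
      (fun q => by
        rw [(hDv1 q (u, 0)).fderiv]
        refine ContinuousLinearMap.ext fun w => ?_
        exact hflat q w (u, 0)) q 0
    simpa only [hD1] using this
  have hf1' : ∀ q, (f q).1 = (f 0).1 + A 0 *ᵥ q.1 := by
    intro q
    have := eq_add_of_hasFDerivAt (g := fun q => (f q).1)
      (L := (ContinuousLinearMap.fst ℝ (Fin n ⊕ Fin n → ℝ) ℝ).comp (D 0)) (fun q => by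
        refine (hf1 q).congr_fderiv ?_
        refine ContinuousLinearMap.ext fun v => ?_
        change (D q v).1 = (D 0 v).1
        rw [hD1, hD1, hAc]) q
    rw [this]
    exact congrArg _ (hD1 0 q)
  -- Solve `f^*α = μ α` for the `z`-component. The terms depending on `q` cancel because `A` scales
  -- `ω` by `μ`.
  have hD2' : ∀ q v, (D q v).2 = μ 0 * v.2 - 1 / 2 * symp b (f 0).1 (A 0 *ᵥ v.1) := by
    intro q v
    have h1 := hα q v
    have h2 : symp b (A 0 *ᵥ q.1) (A 0 *ᵥ v.1) = μ 0 * symp b q.1 v.1 := by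
      rw [symp_eq, symp_eq, (transpose_mul_mul_eq_iff _ _ _).mp (hΩ 0) q.1 v.1, smul_mulVec,
        dotProduct_smul, smul_eq_mul]
    rw [contactForm_apply, contactForm_apply, hD1, hAc, hμc, hf1', symp_add_left, h2] at h1
    linarith
  refine ⟨A 0, μ 0, hG 0, hΩ 0, ?_, fun q => Prod.ext (hf1' q) ?_⟩
  · exact sq_eq_one_iff.mp (hμsq 0)
  · have := congrArg Prod.snd (eq_add_of_hasFDerivAt (g := f) (L := D 0) (fun q => by
        refine (hD q).congr_fderiv ?_
        refine ContinuousLinearMap.ext fun v => Prod.ext ?_ ?_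
        · rw [hD1, hD1, hAc]
        · rw [hD2', hD2']) q)
    rw [this, Prod.snd_add, hD2']
    simp only
    ring


/-! ### The affine isometries -/

/-- The linear part of the left translation by `(c, d)` after `(x, y, z) ↦ (A (x, y), z)`. -/
noncomputable def affineDeriv {n : ℕ} (b : Fin n → ℝ)
    (A : Matrix (Fin n ⊕ Fin n) (Fin n ⊕ Fin n) ℝ) (c : Fin n ⊕ Fin n → ℝ) :
    Coord n →L[ℝ] Coord n :=
  let T : Coord n →L[ℝ] (Fin n ⊕ Fin n → ℝ) :=
    (LinearMap.toContinuousLinearMap (Matrix.toLin' A)).comp (ContinuousLinearMap.fst ℝ _ ℝ)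
  T.prod (ContinuousLinearMap.snd ℝ _ ℝ - (1 / 2 : ℝ) • (gramForm (gramSymp b) c).comp T)

theorem affineDeriv_apply {n : ℕ} (b : Fin n → ℝ)
    (A : Matrix (Fin n ⊕ Fin n) (Fin n ⊕ Fin n) ℝ) (c : Fin n ⊕ Fin n → ℝ) (v : Coord n) :
    affineDeriv b A c v = (A *ᵥ v.1, v.2 - 1 / 2 * symp b c (A *ᵥ v.1)) := by
  rw [symp_eq_gramForm]
  rfl

/-- In the product basis `L` is block lower triangular with diagonal blocks `A` and `μ`. -/
theorem det_of_fst_snd {m : Type*} [Fintype m] [DecidableEq m]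
    (L : (m → ℝ) × ℝ →ₗ[ℝ] (m → ℝ) × ℝ) (A : Matrix m m ℝ) (μ : ℝ)
    (h1 : ∀ v, (L v).1 = A *ᵥ v.1) (h2 : (L (0, 1)).2 = μ) : LinearMap.det L = A.det * μ := by
  let B := (Pi.basisFun ℝ m).prod (Module.Basis.singleton Unit ℝ)
  rw [← LinearMap.det_toMatrix B]
  have : LinearMap.toMatrix B B L = fromBlocks A 0
      (of fun _ j => (L (Pi.single j 1, 0)).2) (of fun _ _ => μ) := by
    ext (i | i) (j | j) <;> simp [B, LinearMap.toMatrix_apply, h1, h2]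
  rw [this, det_fromBlocks_zero₁₂]
  simp

/-- Such a map satisfies `f^*α = α`, so it preserves `H`. Its matrix on `H` is `A`, and `det A = 1`
because `A` preserves `ω`, which settles both orientations. -/
theorem isIsometry_and_orientation_of_affine {n : ℕ} {b p r : Fin n → ℝ} (hb : ∀ j, 0 < b j)
    (hp : ∀ j, p j = -1 ∨ p j = 1) (hr : ∀ j, r j = -1 ∨ r j = 1) {f : Equiv.Perm (Coord n)}
    {A : Matrix (Fin n ⊕ Fin n) (Fin n ⊕ Fin n) ℝ}
    (hG : Aᵀ * gramMetric p r * A = gramMetric p r) (hΩ : Aᵀ * gramSymp b * A = gramSymp b)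
    {a : Coord n} (hf : ∀ q, f q = a + affineDeriv b A a.1 q) (hs : ContDiff ℝ ∞ f.symm) :
    IsIsometry b p r f ∧ IsOrientationPreserving b f := by
  have hA := isUnit_det_of_preserves (isUnit_det_gramMetric hp hr) hG
  have hfun : (f : Coord n → Coord n) = fun q => a + affineDeriv b A a.1 q := funext hf
  have hD : ∀ q, fderiv ℝ f q = affineDeriv b A a.1 := fun q => by
    rw [hfun, fderiv_const_add, ContinuousLinearMap.fderiv]
  have hsymp : ∀ u v, symp b (A *ᵥ u) (A *ᵥ v) = symp b u v := fun u v => by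
    rw [symp_eq, symp_eq]
    exact (transpose_mul_mul_eq_iff _ _ _).mp hΩ u v
  have hα : ∀ q v, contactForm b (f q) (affineDeriv b A a.1 v) = contactForm b q v := by
    intro q v
    rw [hf, contactForm_apply, contactForm_apply, affineDeriv_apply, affineDeriv_apply]
    simp only [Prod.fst_add, symp_add_left, hsymp]
    ring
  have hdet : A.det = 1 := det_eq_one_of_preserves_gramSymp hb hΩ
  refine ⟨⟨?_, hs, fun q => ?_, fun q v _ w _ => ?_⟩, ⟨fun q => ?_, fun q => ?_⟩⟩
  · rw [hfun]
    exact contDiff_const.add (ContinuousLinearMap.contDiff _)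
  · rw [hD]
    ext w
    rw [Submodule.mem_map]
    constructor
    · rintro ⟨v, hv, rfl⟩
      rw [mem_dist_iff] at hv ⊢
      exact (hα q v).trans hv
    · intro hw
      -- The preimage comes from solving the triangular system, first for the `(x,y)`-part and then
      -- for `z`.
      have h1 : (affineDeriv b A a.1 (A⁻¹ *ᵥ w.1, w.2 + 1 / 2 * symp b a.1 w.1)) = w := by
        rw [affineDeriv_apply, Matrix.mulVec_mulVec, mul_nonsing_inv A hA, Matrix.one_mulVec]
        exact Prod.ext rfl (by simp)
      refine ⟨_, ?_, h1⟩
      rw [mem_dist_iff, ← hα q, h1]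
      exact mem_dist_iff.mp hw
  · rw [hD, metric_eq, metric_eq, affineDeriv_apply, affineDeriv_apply]
    exact (transpose_mul_mul_eq_iff _ _ _).mp hG _ _
  · rw [hD, det_of_fst_snd _ A 1, hdet]
    · norm_num
    · intro v
      exact congrArg Prod.fst (affineDeriv_apply b A a.1 v)
    · refine (congrArg Prod.snd (affineDeriv_apply b A a.1 (0, 1))).trans ?_
      simp [symp_zero_right]
  · refine ⟨A, fun k => ?_, by rw [hdet]; norm_num⟩
    rw [hD]
    set v := affineDeriv b A a.1 (frame b k q) with hv
    have h1 : v ∈ dist b (f q) := by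
      rw [mem_dist_iff, hv, hα, ← mem_dist_iff]
      exact Submodule.subset_span ⟨k, rfl⟩
    have h2 : ∑ l, A l k • frame b l (f q) ∈ dist b (f q) :=
      Submodule.sum_mem _ fun l _ => Submodule.smul_mem _ _ (Submodule.subset_span ⟨l, rfl⟩)
    have h3 : v.1 = (∑ l, A l k • frame b l (f q)).1 := by
      rw [hv, affineDeriv_apply, frame_eq, Prod.fst_sum]
      simp only [frame_eq, Prod.smul_mk]
      ext l
      simp [Finset.sum_apply, Pi.single_apply]
    rw [mem_dist_iff, contactForm_apply] at h1 h2
    refine Prod.ext h3 ?_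
    rw [← h3] at h2
    linarith

/-! ### The structure group as a group of matrices -/

theorem emb_injective {n : ℕ} (c : Composition n) (i : Fin c.length) :
    Function.Injective (emb c i) :=
  Sum.map_injective.mpr ⟨Subtype.val_injective, Subtype.val_injective⟩

theorem gramMetric_submatrix {n : ℕ} (c : Composition n) (p r : Fin n → ℝ) (i : Fin c.length) :
    (gramMetric p r).submatrix (emb c i) (emb c i) = diagonal (Sum.elim p r ∘ emb c i) := by
  rw [gramMetric, submatrix_diagonal _ _ (emb_injective c i)]

theorem gramMetric_submatrix_mul_self {n : ℕ} (c : Composition n) {p r : Fin n → ℝ}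
    (hp : ∀ j, p j = -1 ∨ p j = 1) (hr : ∀ j, r j = -1 ∨ r j = 1) (i : Fin c.length) :
    (gramMetric p r).submatrix (emb c i) (emb c i) *
      (gramMetric p r).submatrix (emb c i) (emb c i) = 1 := by
  rw [gramMetric_submatrix, diagonal_mul_diagonal, ← diagonal_one]
  congr 1
  ext (j | j)
  · rcases hp j with h | h <;> simp [h, emb]
  · rcases hr j with h | h <;> simp [h, emb]

theorem dotProduct_gramMetric_eq_sum_block {n : ℕ} (c : Composition n) (p r : Fin n → ℝ)
    (v w : Fin n ⊕ Fin n → ℝ) :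
    v ⬝ᵥ gramMetric p r *ᵥ w = ∑ i, (v ∘ emb c i) ⬝ᵥ
      (gramMetric p r).submatrix (emb c i) (emb c i) *ᵥ (w ∘ emb c i) := by
  rw [← metric_eq p r (v, 0) (w, 0), metric, ← Equiv.sum_comp (Equiv.sigmaFiberEquiv c.index),
    Fintype.sum_sigma]
  refine Finset.sum_congr rfl fun i _ => ?_
  rw [gramMetric_submatrix]
  simp only [dotProduct, Fintype.sum_sum_type, mulVec_diagonal, Function.comp_apply,
    ← Finset.sum_add_distrib]
  refine Finset.sum_congr rfl fun j _ => ?_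
  simp only [emb, Sum.map_inl, Sum.map_inr, Equiv.sigmaFiberEquiv_apply, Sum.elim_inl,
    Sum.elim_inr]
  ring

theorem act_smul {n : ℕ} {c : Composition n} {b p r : Fin n → ℝ} (σ : StructureGroup c b p r)
    (t : ℝ) (v : Fin n ⊕ Fin n → ℝ) : act σ (t • v) = t • act σ v := by
  refine ext_emb c fun i => ?_
  rw [act_comp_emb, show (t • v) ∘ emb c i = t • (v ∘ emb c i) from rfl,
    Matrix.mulVec_smul, ← act_comp_emb]
  rfl

/-- The matrix of the action of an element of the structure group. -/
noncomputable def actMatrix {n : ℕ} {c : Composition n} {b p r : Fin n → ℝ}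
    (σ : StructureGroup c b p r) : Matrix (Fin n ⊕ Fin n) (Fin n ⊕ Fin n) ℝ :=
  LinearMap.toMatrix' { toFun := act σ, map_add' := act_add σ, map_smul' := act_smul σ }

theorem actMatrix_mulVec {n : ℕ} {c : Composition n} {b p r : Fin n → ℝ}
    (σ : StructureGroup c b p r) (v : Fin n ⊕ Fin n → ℝ) : actMatrix σ *ᵥ v = act σ v :=
  LinearMap.toMatrix'_mulVec _ _

theorem actMatrix_preserves_gramSymp {n : ℕ} {c : Composition n} {b p r : Fin n → ℝ}
    (σ : StructureGroup c b p r) : (actMatrix σ)ᵀ * gramSymp b * actMatrix σ = gramSymp b := by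
  rw [transpose_mul_mul_eq_iff]
  intro u v
  rw [← symp_eq, ← symp_eq, actMatrix_mulVec, actMatrix_mulVec, symp_act]

theorem actMatrix_preserves_gramMetric {n : ℕ} {c : Composition n} {b p r : Fin n → ℝ}
    (σ : StructureGroup c b p r) :
    (actMatrix σ)ᵀ * gramMetric p r * actMatrix σ = gramMetric p r := by
  rw [transpose_mul_mul_eq_iff]
  intro u v
  rw [dotProduct_gramMetric_eq_sum_block c, dotProduct_gramMetric_eq_sum_block c]
  refine Finset.sum_congr rfl fun i _ => ?_
  rw [actMatrix_mulVec, actMatrix_mulVec, act_comp_emb, act_comp_emb]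
  exact (transpose_mul_mul_eq_iff _ _ _).mp (σ i).2.1 _ _

/-- Compression to a coordinate subspace respects a product as soon as the right factor maps that
subspace to itself. -/
theorem submatrix_mul_of_forall_notMem_range {m l : Type*} [Fintype m] [Fintype l]
    [DecidableEq m] {e : l → m} (he : Function.Injective e) (X A : Matrix m m ℝ)
    (h : ∀ k, k ∉ Set.range e → ∀ j, A k (e j) = 0) :
    (X * A).submatrix e e = X.submatrix e e * A.submatrix e e := by
  ext i j
  simp only [submatrix_apply, mul_apply]
  rw [← Finset.sum_image (s := Finset.univ) (f := fun k => X (e i) k * A k (e j))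
    (fun x _ y _ hxy => he hxy)]
  refine (Finset.sum_subset (Finset.subset_univ _) fun k _ hk => ?_).symm
  rw [h k (fun ⟨x, hx⟩ => hk (Finset.mem_image.mpr ⟨x, Finset.mem_univ _, hx⟩)), mul_zero]

/-- The index of the block of an index of the frame. -/
def blockIndex {n : ℕ} (c : Composition n) : Fin n ⊕ Fin n → Fin c.length :=
  Sum.elim c.index c.index

theorem blockIndex_emb {n : ℕ} (c : Composition n) (i : Fin c.length) (k) :
    blockIndex c (emb c i k) = i := by
  rcases k with ⟨j, hj⟩ | ⟨j, hj⟩ <;> exact hj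

theorem mem_range_emb {n : ℕ} {c : Composition n} {i : Fin c.length} {k : Fin n ⊕ Fin n} :
    k ∈ Set.range (emb c i) ↔ blockIndex c k = i := by
  constructor
  · rintro ⟨l, rfl⟩
    exact blockIndex_emb c i l
  · rcases k with j | j
    · exact fun h => ⟨Sum.inl ⟨j, h⟩, rfl⟩
    · exact fun h => ⟨Sum.inr ⟨j, h⟩, rfl⟩

theorem submatrix_mul_of_blockIndex {n : ℕ} (c : Composition n) (i : Fin c.length)
    (X A : Matrix (Fin n ⊕ Fin n) (Fin n ⊕ Fin n) ℝ)
    (h : ∀ k l, blockIndex c k ≠ blockIndex c l → A k l = 0) :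
    (X * A).submatrix (emb c i) (emb c i) =
      X.submatrix (emb c i) (emb c i) * A.submatrix (emb c i) (emb c i) := by
  refine submatrix_mul_of_forall_notMem_range (emb_injective c i) X A fun k hk j => h _ _ ?_
  rwa [blockIndex_emb, Ne, ← mem_range_emb]

/-- Indices in different blocks give different eigenvalues of `J²`, so `A` is block diagonal, and so
are both Gram matrices. The diagonal blocks of `A` then preserve the restricted forms. -/
theorem exists_act_eq {n : ℕ} {c : Composition n} {b p r : Fin n → ℝ} (hb : ∀ j, 0 < b j)
    (hreg : ∀ j j', b j = b j' ↔ c.index j = c.index j')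
    (hp : ∀ j, p j = -1 ∨ p j = 1) (hr : ∀ j, r j = -1 ∨ r j = 1)
    {A : Matrix (Fin n ⊕ Fin n) (Fin n ⊕ Fin n) ℝ}
    (hG : Aᵀ * gramMetric p r * A = gramMetric p r) (hΩ : Aᵀ * gramSymp b * A = gramSymp b) :
    ∃ σ : StructureGroup c b p r, ∀ v, act σ v = A *ᵥ v := by
  have hA : ∀ k l, blockIndex c k ≠ blockIndex c l → A k l = 0 := by
    intro k l hkl
    refine apply_eq_zero_of_sqJ_ne hp hr hG hΩ fun h => hkl ?_
    rcases k with k | k <;> rcases l with l | l <;>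
      exact (hreg _ _).mp ((sqJ_eq_iff hb hp hr _ _).mp (neg_injective h)).1
  have hGb : ∀ k l, blockIndex c k ≠ blockIndex c l → gramMetric p r k l = 0 := by
    intro k l hkl
    exact diagonal_apply_ne _ fun h => hkl (congrArg _ h)
  have hΩb : ∀ k l, blockIndex c k ≠ blockIndex c l → gramSymp b k l = 0 := by
    intro k l hkl
    have key : ∀ k l : Fin n, c.index k ≠ c.index l → k ≠ l := fun k l h h' => h (congrArg _ h')
    rcases k with k | k <;> rcases l with l | l <;> simp [gramSymp, key k l hkl]
  have key : ∀ (S : Matrix (Fin n ⊕ Fin n) (Fin n ⊕ Fin n) ℝ) (i),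
      (∀ k l, blockIndex c k ≠ blockIndex c l → S k l = 0) → Aᵀ * S * A = S →
      (A.submatrix (emb c i) (emb c i))ᵀ * S.submatrix (emb c i) (emb c i) *
        A.submatrix (emb c i) (emb c i) = S.submatrix (emb c i) (emb c i) := by
    intro S i hS h
    conv_rhs => rw [← h]
    rw [submatrix_mul_of_blockIndex c i _ _ hA, submatrix_mul_of_blockIndex c i _ _ hS,
      transpose_submatrix]
  have hu : ∀ i, IsUnit (A.submatrix (emb c i) (emb c i)).det := fun i =>
    isUnit_det_of_preserves (IsUnit.of_mul_eq_one _ (by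
      rw [← det_mul, gramMetric_submatrix_mul_self c hp hr, det_one])) (key _ i hGb hG)
  refine ⟨fun i => ⟨GeneralLinearGroup.mk'' _ (hu i), key _ i hGb hG, key _ i hΩb hΩ⟩,
    fun v => ext_emb c fun i => ?_⟩
  rw [act_comp_emb]
  ext k
  change ∑ l, A (emb c i k) (emb c i l) * v (emb c i l) = ∑ l, A (emb c i k) l * v l
  rw [← Finset.sum_image (s := Finset.univ) (f := fun l => A (emb c i k) l * v l)
    (fun x _ y _ hxy => emb_injective c i hxy)]
  refine Finset.sum_subset (Finset.subset_univ _) fun l _ hl => ?_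
  rw [hA, zero_mul]
  rw [blockIndex_emb]
  intro h
  obtain ⟨x, hx⟩ := mem_range_emb.mpr h.symm
  exact hl (Finset.mem_image.mpr ⟨x, Finset.mem_univ _, hx⟩)

theorem act_injective {n : ℕ} {c : Composition n} {b p r : Fin n → ℝ}
    {σ τ : StructureGroup c b p r} (h : ∀ v, act σ v = act τ v) : σ = τ := by
  funext i
  refine Subtype.ext (Units.ext (Matrix.ext_iff_mulVec.mpr fun w => ?_))
  -- Extending a vector of one block by zero lets the action on the whole space test that block.
  have hw : Function.extend (emb c i) w 0 ∘ emb c i = w := by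
    funext k
    exact (emb_injective c i).extend_apply _ _ _
  rw [← hw, ← act_comp_emb, ← act_comp_emb, h]


/-! ### The group of orientation preserving isometries -/

/-- The diffeomorphism `q ↦ a * f_σ(q)` of `ℝ^{2n+1}` attached to an element `(a, σ)` of the
semidirect product. -/
noncomputable def toPerm {n : ℕ} (c : Composition n) (b p r : Fin n → ℝ) :
    Heis b ⋊[heisAction c b p r] StructureGroup c b p r →* Equiv.Perm (Coord n) :=
  let e : Heis b ≃ Coord n := ⟨fun q => (q.xy, q.z), fun q => ⟨q.1, q.2⟩, fun _ => rfl, fun _ => rfl⟩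
  { toFun := fun x => e.permCongr
      ((heisAction c b p r x.right).toEquiv.trans (Equiv.mulLeft x.left))
    map_one' := by
      ext1 q
      simp [Equiv.permCongr_apply]
    map_mul' := fun x y => by
      ext1 q
      simp [Equiv.permCongr_apply] }

theorem toPerm_apply {n : ℕ} {c : Composition n} {b p r : Fin n → ℝ}
    (x : Heis b ⋊[heisAction c b p r] StructureGroup c b p r) (q : Coord n) :
    toPerm c b p r x q = (x.left.xy + act x.right q.1,
      x.left.z + q.2 - 1 / 2 * symp b x.left.xy (act x.right q.1)) := by
  change ((x.left * (⟨act x.right q.1, q.2⟩ : Heis b)).xy,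
    (x.left * (⟨act x.right q.1, q.2⟩ : Heis b)).z) = _
  rw [Heis.mul_eq]

theorem toPerm_eq_affineDeriv {n : ℕ} {c : Composition n} {b p r : Fin n → ℝ}
    (x : Heis b ⋊[heisAction c b p r] StructureGroup c b p r) (q : Coord n) :
    toPerm c b p r x q =
      (x.left.xy, x.left.z) + affineDeriv b (actMatrix x.right) x.left.xy q := by
  rw [toPerm_apply, affineDeriv_apply, actMatrix_mulVec]
  exact Prod.ext rfl (add_sub_assoc _ _ _)

theorem contDiff_toPerm {n : ℕ} {c : Composition n} {b p r : Fin n → ℝ}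
    (x : Heis b ⋊[heisAction c b p r] StructureGroup c b p r) :
    ContDiff ℝ ∞ (toPerm c b p r x) := by
  rw [show (toPerm c b p r x : Coord n → Coord n) = _ from funext (toPerm_eq_affineDeriv x)]
  exact contDiff_const.add (ContinuousLinearMap.contDiff _)

theorem toPerm_mem {n : ℕ} {c : Composition n} {b p r : Fin n → ℝ} (hb : ∀ j, 0 < b j)
    (hp : ∀ j, p j = -1 ∨ p j = 1) (hr : ∀ j, r j = -1 ∨ r j = 1)
    (x : Heis b ⋊[heisAction c b p r] StructureGroup c b p r) :
    toPerm c b p r x ∈ orientedIsometryGroup b p r := by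
  -- The inverse map belongs to `x⁻¹`, hence is again affine.
  have hs : ContDiff ℝ ∞ (toPerm c b p r x).symm := by
    have := contDiff_toPerm x⁻¹
    rwa [map_inv] at this
  exact isIsometry_and_orientation_of_affine hb hp hr (actMatrix_preserves_gramMetric x.right)
    (actMatrix_preserves_gramSymp x.right) (toPerm_eq_affineDeriv x) hs

theorem toPerm_zero {n : ℕ} {c : Composition n} {b p r : Fin n → ℝ}
    (x : Heis b ⋊[heisAction c b p r] StructureGroup c b p r) :
    toPerm c b p r x 0 = (x.left.xy, x.left.z) := by
  rw [toPerm_eq_affineDeriv, map_zero, add_zero]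

theorem toPerm_injective {n : ℕ} {c : Composition n} {b p r : Fin n → ℝ} :
    Function.Injective (toPerm c b p r) := by
  intro x y h
  have h0 : (x.left.xy, x.left.z) = (y.left.xy, y.left.z) := by
    rw [← toPerm_zero, ← toPerm_zero, h]
  have h1 : x.left.xy = y.left.xy := congrArg Prod.fst h0
  refine SemidirectProduct.ext (Heis.ext h1 (congrArg Prod.snd h0)) (act_injective fun v => ?_)
  have h2 := congrArg (fun f : Equiv.Perm (Coord n) => (f (v, 0)).1) h
  simp only [toPerm_apply] at h2
  rw [h1] at h2
  exact add_left_cancel h2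

/-- By `IsIsometry.exists_eq` only the sign `μ` can obstruct surjectivity. The orientation of `H`
gives `det A > 0` and that of the tangent bundle gives `det A · μ > 0`, so `μ = 1`. -/
theorem toPerm_surjective {n : ℕ} (hn : 1 ≤ n) {c : Composition n} {b p r : Fin n → ℝ}
    (hb : ∀ j, 0 < b j) (hreg : ∀ j j', b j = b j' ↔ c.index j = c.index j')
    (hp : ∀ j, p j = -1 ∨ p j = 1) (hr : ∀ j, r j = -1 ∨ r j = 1) {f : Equiv.Perm (Coord n)}
    (hf : f ∈ orientedIsometryGroup b p r) : ∃ x, toPerm c b p r x = f := by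
  obtain ⟨A, μ, hG, hΩ, hμ, hfq⟩ := hf.1.exists_eq hn hb hp hr
  have hD : ∀ q, HasFDerivAt f (fderiv ℝ f q) q := fun q =>
    (hf.1.smooth.differentiable (by simp) q).hasFDerivAt
  have h1 : ∀ q v, (fderiv ℝ f q v).1 = A *ᵥ v.1 := by
    intro q v
    have e1 := (hD q).fst
    have e2 : HasFDerivAt (fun q : Coord n => (f 0).1 + A *ᵥ q.1)
        ((LinearMap.toContinuousLinearMap (Matrix.toLin' A)).comp
          (ContinuousLinearMap.fst ℝ (Fin n ⊕ Fin n → ℝ) ℝ)) q :=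
      (ContinuousLinearMap.hasFDerivAt ((LinearMap.toContinuousLinearMap (Matrix.toLin' A)).comp
          (ContinuousLinearMap.fst ℝ (Fin n ⊕ Fin n → ℝ) ℝ))).const_add _
    rw [show (fun q => (f q).1) = fun q : Coord n => (f 0).1 + A *ᵥ q.1 from
      funext fun q => congrArg Prod.fst (hfq q)] at e1
    exact DFunLike.congr_fun (e1.unique e2) v
  have h2 : (fderiv ℝ f 0 (0, 1)).2 = μ := by
    have hline : HasDerivAt (fun t : ℝ => ((0, t) : Coord n)) (0, 1) 0 :=
      (hasDerivAt_const _ _).prodMk (hasDerivAt_id _)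
    have e1 := ((hD 0).snd.comp_hasDerivAt_of_eq 0 hline rfl)
    have e2 : HasDerivAt (fun t : ℝ => (f 0).2 + μ * t) μ 0 := by
      simpa using ((hasDerivAt_id (0 : ℝ)).const_mul μ).const_add (f 0).2
    refine e1.unique (e2.congr_of_eventuallyEq (Filter.Eventually.of_forall fun t => ?_))
    change (f (0, t)).2 = _
    rw [hfq]
    simp [symp_zero_right]
  obtain ⟨M, hM, hMdet⟩ := hf.2.horizontal 0
  -- The `(x,y)`-part of a horizontal vector lists its frame coefficients, so the matrix witnessing
  -- the orientation of `H` must be `A`.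
  have hMA : M = A := by
    ext l k
    have := congrFun (congrArg Prod.fst (hM k)) l
    rw [h1, frame_eq, Prod.fst_sum] at this
    simp only [frame_eq, Prod.smul_mk, Finset.sum_apply, Pi.smul_apply, Pi.single_apply,
      smul_eq_mul, mul_ite, mul_one, mul_zero, Finset.sum_ite_eq, Finset.mem_univ, if_true] at this
    rw [← this]
    simp
  have hdet := hf.2.tangent 0
  rw [det_of_fst_snd _ A μ (h1 0) h2] at hdet
  rw [hMA] at hMdet
  have hμ1 : μ = 1 := hμ.resolve_right fun h => by
    rw [h] at hdet
    linarith
  rw [hμ1, one_smul] at hΩ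
  obtain ⟨σ, hσ⟩ := exists_act_eq (c := c) hb hreg hp hr hG hΩ
  refine ⟨⟨⟨(f 0).1, (f 0).2⟩, σ⟩, Equiv.ext fun q => ?_⟩
  rw [toPerm_apply, hfq q, hσ, hμ1, one_mul]

theorem continuous_heis_iff {n : ℕ} {b : Fin n → ℝ} {X : Type*} [TopologicalSpace X]
    {g : X → Heis b} : Continuous g ↔ Continuous (fun x => (g x).xy) ∧ Continuous fun x => (g x).z :=
  continuous_induced_rng.trans continuous_prodMk

theorem continuous_semidirect_iff {N G X : Type*} [Group N] [Group G] [TopologicalSpace N]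
    [TopologicalSpace G] [TopologicalSpace X] {φ : G →* MulAut N} {g : X → N ⋊[φ] G} :
    Continuous g ↔ Continuous (fun x => (g x).left) ∧ Continuous fun x => (g x).right :=
  continuous_induced_rng.trans continuous_prodMk

theorem continuous_toPerm {n : ℕ} (c : Composition n) (b p r : Fin n → ℝ) :
    Continuous fun x : (Heis b ⋊[heisAction c b p r] StructureGroup c b p r) × Coord n =>
      toPerm c b p r x.1 x.2 := by
  obtain ⟨hl, hR⟩ := continuous_semidirect_iff.mp
    (continuous_fst (X := Heis b ⋊[heisAction c b p r] StructureGroup c b p r) (Y := Coord n))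
  obtain ⟨h1, h2⟩ := continuous_heis_iff.mp hl
  have hi : ∀ i, Continuous fun x : (Heis b ⋊[heisAction c b p r] StructureGroup c b p r) ×
      Coord n => (x.1.right i).1.1 *ᵥ (x.2.1 ∘ emb c i) := fun i => by
    refine Continuous.matrix_mulVec ?_ ?_
    · exact Units.continuous_val.comp (continuous_subtype_val.comp ((continuous_apply i).comp hR))
    · exact continuous_pi fun k => (continuous_apply _).comp (continuous_fst.comp continuous_snd)
  have hact : Continuous fun x : (Heis b ⋊[heisAction c b p r] StructureGroup c b p r) ×
      Coord n => act x.1.right x.2.1 := by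
    refine continuous_pi fun k => ?_
    rcases k with j | j
    · exact (continuous_apply (Sum.inl ⟨j, rfl⟩)).comp (hi (c.index j))
    · exact (continuous_apply (Sum.inr ⟨j, rfl⟩)).comp (hi (c.index j))
  simp only [toPerm_apply, symp_eq_gramForm]
  exact (h1.add hact).prodMk ((h2.add (continuous_snd.comp continuous_snd)).sub
    (continuous_const.mul (((gramForm (gramSymp b)).continuous.comp h1).clm_apply hact)))

/-- The topology on units also asks for continuity of the inverse. Here `A⁻¹ = G Aᵀ G`, because `Aᵀ
G A = G` and `G² = 1`. -/
theorem continuous_structureGroup_of_val {n : ℕ} {c : Composition n} {b p r : Fin n → ℝ}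
    (hp : ∀ j, p j = -1 ∨ p j = 1) (hr : ∀ j, r j = -1 ∨ r j = 1) {X : Type*} [TopologicalSpace X]
    {g : X → StructureGroup c b p r} (h : ∀ i, Continuous fun x => (g x i).1.1) :
    Continuous g := by
  refine continuous_pi fun i => continuous_induced_rng.mpr
    (Units.continuous_iff.mpr ⟨h i, ?_⟩)
  have key : ∀ x, ((g x i).1⁻¹).1 = (gramMetric p r).submatrix (emb c i) (emb c i) *
      (g x i).1.1ᵀ * (gramMetric p r).submatrix (emb c i) (emb c i) := by
    intro x
    have h1 := (g x i).2.1
    have h2 : (g x i).1.1 * ((g x i).1⁻¹).1 = 1 := (g x i).1.mul_inv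
    have h3 := gramMetric_submatrix_mul_self c hp hr i
    calc ((g x i).1⁻¹).1 = (gramMetric p r).submatrix (emb c i) (emb c i) *
          ((g x i).1.1ᵀ * (gramMetric p r).submatrix (emb c i) (emb c i) * (g x i).1.1) *
            ((g x i).1⁻¹).1 := by rw [h1, h3, Matrix.one_mul]
      _ = (gramMetric p r).submatrix (emb c i) (emb c i) *
          (g x i).1.1ᵀ * (gramMetric p r).submatrix (emb c i) (emb c i) *
            ((g x i).1.1 * ((g x i).1⁻¹).1) := by simp only [Matrix.mul_assoc]
      _ = _ := by rw [h2, Matrix.mul_one]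
  simp only [Function.comp_apply, key]
  exact (continuous_const.matrix_mul (h i).matrix_transpose).matrix_mul continuous_const

/-- Joint continuity of the action gives continuity into the compact-open topology. For the inverse,
evaluations at points are continuous and already recover all parameters. -/
theorem nonempty_continuousMulEquiv {n : ℕ} (hn : 1 ≤ n) (c : Composition n) {b p r : Fin n → ℝ}
    (hb : ∀ j, 0 < b j) (hreg : ∀ j j', b j = b j' ↔ c.index j = c.index j')
    (hp : ∀ j, p j = -1 ∨ p j = 1) (hr : ∀ j, r j = -1 ∨ r j = 1) :
    Nonempty ((Heis b ⋊[heisAction c b p r] StructureGroup c b p r) ≃ₜ*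
      orientedIsometryGroup b p r) := by
  let Φ := (toPerm c b p r).codRestrict (orientedIsometryGroup b p r) (toPerm_mem hb hp hr)
  have hΦ : Function.Bijective Φ := by
    refine ⟨fun x y h => toPerm_injective (congrArg Subtype.val h), fun f => ?_⟩
    obtain ⟨x, hx⟩ := toPerm_surjective hn (c := c) hb hreg hp hr f.2
    exact ⟨x, Subtype.ext hx⟩
  let e := MulEquiv.ofBijective Φ hΦ
  have heval : ∀ q : Coord n, Continuous fun f : orientedIsometryGroup b p r => f.1 q := fun q =>
    (continuous_eval_const (F := C(Coord n, Coord n)) q).comp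
      (continuous_induced_dom (f := toContinuousMap b p r))
  have he : ∀ f q, toPerm c b p r (e.symm f) q = f.1 q := fun f q =>
    congrArg (fun f : orientedIsometryGroup b p r => f.1 q) (e.apply_symm_apply f)
  refine ⟨{ e with continuous_toFun := ?_, continuous_invFun := ?_ }⟩
  · refine continuous_induced_rng.mpr ?_
    exact ContinuousMap.continuous_of_continuous_uncurry _ (continuous_toPerm c b p r)
  · have h0 : ∀ f, ((e.symm f).left.xy, (e.symm f).left.z) = f.1 0 := fun f => by
      rw [← toPerm_zero, he]
    refine continuous_semidirect_iff.mpr ⟨continuous_heis_iff.mpr ⟨?_, ?_⟩,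
      continuous_structureGroup_of_val hp hr fun i => ?_⟩
    · exact (continuous_fst.comp (heval 0)).congr fun f => (congrArg Prod.fst (h0 f)).symm
    · exact (continuous_snd.comp (heval 0)).congr fun f => (congrArg Prod.snd (h0 f)).symm
    · refine continuous_matrix fun k l => ?_
      -- A matrix entry is the difference of the values of `f` at a basis vector and at the origin.
      have hkl : ∀ f, (f.1 (Pi.single (emb c i l) 1, 0)).1 (emb c i k) - (f.1 0).1 (emb c i k) =
          ((e.symm f).right i).1.1 k l := by
        intro f
        rw [← he, ← he, toPerm_zero, toPerm_apply]
        simp only [Pi.add_apply, add_sub_cancel_left]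
        have h1 := congrFun (act_comp_emb (e.symm f).right (Pi.single (emb c i l) 1) i) k
        rw [Function.comp_apply] at h1
        rw [h1, show (Pi.single (emb c i l) (1 : ℝ) : Fin n ⊕ Fin n → ℝ) ∘ emb c i =
          Pi.single l 1 from funext fun x => by
            simp [Pi.single_apply, (emb_injective c i).eq_iff], mulVec_single_one]
        rfl
      refine Continuous.congr ?_ hkl
      exact ((continuous_apply _).comp (continuous_fst.comp (heval _))).sub
        ((continuous_apply _).comp (continuous_fst.comp (heval _)))


/-! ### The Lie algebra of the structure group -/

/-- The Lie algebra of `Sp(ω) ∩ O(g)`. -/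
def lieAlg {n : ℕ} (b p r : Fin n → ℝ) : Submodule ℝ (Matrix (Fin n ⊕ Fin n) (Fin n ⊕ Fin n) ℝ) where
  carrier := {S | Sᵀ * gramMetric p r + gramMetric p r * S = 0 ∧
    Sᵀ * gramSymp b + gramSymp b * S = 0}
  zero_mem' := by simp
  add_mem' := by
    have key : ∀ S T G : Matrix (Fin n ⊕ Fin n) (Fin n ⊕ Fin n) ℝ, Sᵀ * G + G * S = 0 →
        Tᵀ * G + G * T = 0 → (S + T)ᵀ * G + G * (S + T) = 0 := by
      intro S T G hS hT
      rw [transpose_add, Matrix.add_mul, Matrix.mul_add, add_add_add_comm, hS, hT, add_zero]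
    exact fun {S T} hS hT => ⟨key _ _ _ hS.1 hT.1, key _ _ _ hS.2 hT.2⟩
  smul_mem' := by
    have key : ∀ (t : ℝ) (S G : Matrix (Fin n ⊕ Fin n) (Fin n ⊕ Fin n) ℝ), Sᵀ * G + G * S = 0 →
        (t • S)ᵀ * G + G * (t • S) = 0 := by
      intro t S G hS
      rw [transpose_smul, Matrix.smul_mul, Matrix.mul_smul, ← smul_add, hS, smul_zero]
    exact fun t S hS => ⟨key _ _ _ hS.1, key _ _ _ hS.2⟩

/-- Six of the eight block equations suffice: each of the other two is, up to sign, the transpose of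
one of them. -/
theorem fromBlocks_mem_lieAlg {n : ℕ} {b p r : Fin n → ℝ} {A B C D : Matrix (Fin n) (Fin n) ℝ} :
    fromBlocks A B C D ∈ lieAlg b p r ↔
      (∀ i j, p j * A j i + p i * A i j = 0) ∧ (∀ i j, r j * C j i + p i * B i j = 0) ∧
      (∀ i j, r j * D j i + r i * D i j = 0) ∧ (∀ i j, b i * C i j - b j * C j i = 0) ∧
      (∀ i j, b j * A j i + b i * D i j = 0) ∧ (∀ i j, b j * B j i - b i * B i j = 0) := by
  have h1 : gramMetric p r = fromBlocks (diagonal p) 0 0 (diagonal r) :=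
    (fromBlocks_diagonal p r).symm
  change (_ ∧ _) ↔ _
  rw [h1, gramSymp]
  simp only [fromBlocks_transpose, fromBlocks_multiply, fromBlocks_add, Matrix.mul_zero,
    Matrix.zero_mul, add_zero, zero_add, Matrix.mul_neg, Matrix.neg_mul,
    ← fromBlocks_zero, fromBlocks_inj]
  simp only [← Matrix.ext_iff, Matrix.add_apply, Matrix.neg_apply,
    mul_diagonal, diagonal_mul, transpose_apply, Matrix.zero_apply]
  constructor
  · rintro ⟨⟨a1, a2, -, a4⟩, c1, c2, -, c4⟩
    refine ⟨fun i j => ?_, fun i j => ?_, fun i j => ?_, fun i j => ?_, fun i j => ?_,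
      fun i j => ?_⟩
    · linear_combination a1 i j
    · linear_combination a2 i j
    · linear_combination a4 i j
    · linear_combination c1 i j
    · linear_combination c2 i j
    · linear_combination c4 i j
  · rintro ⟨h1, h2, h3, h4, h5, h6⟩
    refine ⟨⟨fun i j => ?_, fun i j => ?_, fun i j => ?_, fun i j => ?_⟩, fun i j => ?_,
      fun i j => ?_, fun i j => ?_, fun i j => ?_⟩
    · linear_combination h1 i j
    · linear_combination h2 i j
    · linear_combination h2 j i
    · linear_combination h3 i j
    · linear_combination h4 i j
    · linear_combination h5 i j
    · linear_combination -h5 j i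
    · linear_combination h6 i j

/-- The pairs of indices in the same block for which `J²` has the same sign. -/
abbrev ClassPair {n : ℕ} (b p r : Fin n → ℝ) : Type :=
  {x : Fin n × Fin n // b x.1 = b x.2 ∧ p x.1 * r x.1 = p x.2 * r x.2}

theorem mul_self_eq_one_of_sign {x : ℝ} (h : x = -1 ∨ x = 1) : x * x = 1 := by
  rcases h with h | h <;> simp [h]

/-- The infinitesimal form of `apply_eq_zero_of_sqJ_ne`: eliminating the remaining blocks leaves a
difference of eigenvalues of `J²` times the entry. -/
theorem lieAlg_apply_eq_zero {n : ℕ} {b p r : Fin n → ℝ} (hb : ∀ j, 0 < b j)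
    (hp : ∀ j, p j = -1 ∨ p j = 1) (hr : ∀ j, r j = -1 ∨ r j = 1)
    {A B C D : Matrix (Fin n) (Fin n) ℝ} (h : fromBlocks A B C D ∈ lieAlg b p r) {i j : Fin n}
    (hij : ¬(b i = b j ∧ p i * r i = p j * r j)) : A i j = 0 ∧ C i j = 0 := by
  obtain ⟨h1, h2, h3, h4, h5, h6⟩ := fromBlocks_mem_lieAlg.mp h
  have hne : p i * r i * b i ^ 2 - p j * r j * b j ^ 2 ≠ 0 := fun h0 =>
    hij ((sqJ_eq_iff hb hp hr i j).mp (sub_eq_zero.mp h0))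
  have pi := mul_self_eq_one_of_sign (hp i)
  have pj := mul_self_eq_one_of_sign (hp j)
  have ri := mul_self_eq_one_of_sign (hr i)
  have rj := mul_self_eq_one_of_sign (hr j)
  constructor
  · refine (mul_eq_zero.mp (?_ : (p i * r i * b i ^ 2 - p j * r j * b j ^ 2) * A i j = 0)).resolve_left
      hne
    have f1 : p i * A j i + p j * A i j = 0 := by
      linear_combination p i * p j * h1 i j - p i * A j i * pj - p j * A i j * pi
    have f2 : r i * D j i + r j * D i j = 0 := by
      linear_combination r i * r j * h3 i j - r i * D j i * rj - r j * D i j * ri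
    linear_combination p i * r i * b i * h5 j i - p i * b i * b j * f2 + p i * b j * r j * h5 i j -
      r j * b j ^ 2 * f1
  · refine (mul_eq_zero.mp (?_ : (p i * r i * b i ^ 2 - p j * r j * b j ^ 2) * C i j = 0)).resolve_left
      hne
    have g1 : B j i + p j * r i * C i j = 0 := by
      linear_combination p j * h2 j i - B j i * pj
    have g2 : B i j + p i * r j * C j i = 0 := by
      linear_combination p i * h2 i j - B i j * pi
    have g3 : b i ^ 2 * p i * r j * C i j - b j ^ 2 * p j * r i * C i j = 0 := by
      linear_combination b i * p i * r j * h4 i j + b i * b j * g2 - b j ^ 2 * g1 + b j * h6 i j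
    linear_combination r i * r j * g3 - b i ^ 2 * p i * r i * C i j * rj +
      b j ^ 2 * p j * r j * C i j * ri

open Classical in
/-- Extension by zero of a function on the pairs. -/
noncomputable def extendPair {n : ℕ} {b p r : Fin n → ℝ} (M : ClassPair b p r → ℝ)
    (i j : Fin n) : ℝ :=
  if h : b i = b j ∧ p i * r i = p j * r j then M ⟨(i, j), h⟩ else 0

/-- The element of the Lie algebra with given coordinates. -/
noncomputable def ofPair {n : ℕ} {b p r : Fin n → ℝ} (M : ClassPair b p r → ℝ) :
    Matrix (Fin n ⊕ Fin n) (Fin n ⊕ Fin n) ℝ :=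
  fromBlocks (of fun i j => p i / 2 * (extendPair M i j - extendPair M j i))
    (of fun i j => -(p i * r j / 2 * (extendPair M i j + extendPair M j i)))
    (of fun i j => 1 / 2 * (extendPair M i j + extendPair M j i))
    (of fun i j => -(p j / 2 * (extendPair M j i - extendPair M i j)))

theorem ofPair_mem {n : ℕ} {b p r : Fin n → ℝ}
    (hp : ∀ j, p j = -1 ∨ p j = 1) (hr : ∀ j, r j = -1 ∨ r j = 1) (M : ClassPair b p r → ℝ) :
    ofPair M ∈ lieAlg b p r := by
  have key : ∀ i j, (extendPair M i j = 0 ∧ extendPair M j i = 0) ∨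
      (b i = b j ∧ p i * r j = p j * r i) := by
    intro i j
    by_cases h : b i = b j ∧ p i * r i = p j * r j
    · refine Or.inr ⟨h.1, ?_⟩
      linear_combination r i * r j * h.2 - p i * r j * mul_self_eq_one_of_sign (hr i) +
        p j * r i * mul_self_eq_one_of_sign (hr j)
    · refine Or.inl ⟨dif_neg h, dif_neg fun h' => h ⟨h'.1.symm, h'.2.symm⟩⟩
  refine fromBlocks_mem_lieAlg.mpr ⟨fun i j => ?_, fun i j => ?_, fun i j => ?_, fun i j => ?_,
    fun i j => ?_, fun i j => ?_⟩ <;> simp only [of_apply]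
  · linear_combination (extendPair M j i - extendPair M i j) / 2 *
      (mul_self_eq_one_of_sign (hp j) - mul_self_eq_one_of_sign (hp i))
  · linear_combination -r j * (extendPair M j i + extendPair M i j) / 2 *
      mul_self_eq_one_of_sign (hp i)
  · rcases key i j with ⟨h, h'⟩ | ⟨-, h⟩
    · rw [h, h']; ring
    · linear_combination (extendPair M j i - extendPair M i j) / 2 * h
  · rcases key i j with ⟨h, h'⟩ | ⟨h, -⟩
    · rw [h, h']; ring
    · rw [h]; ring
  · rcases key i j with ⟨h, h'⟩ | ⟨h, -⟩
    · rw [h, h']; ring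
    · rw [h]; ring
  · rcases key i j with ⟨h, h'⟩ | ⟨h, h'⟩
    · rw [h, h']; ring
    · rw [h]
      linear_combination b j * (extendPair M j i + extendPair M i j) / 2 * h'

/-- Coordinates on the Lie algebra of the structure group. -/
noncomputable def lieAlgEquiv {n : ℕ} {b p r : Fin n → ℝ} (hb : ∀ j, 0 < b j)
    (hp : ∀ j, p j = -1 ∨ p j = 1) (hr : ∀ j, r j = -1 ∨ r j = 1) :
    lieAlg b p r ≃ₗ[ℝ] (ClassPair b p r → ℝ) where
  -- The block `C` is symmetric and `p A` is antisymmetric, so their sum retains both. The blocks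
  -- `B` and `D` are determined by `C` and `A`.
  toFun S x := S.1 (Sum.inr x.1.1) (Sum.inl x.1.2) +
    p x.1.1 * S.1 (Sum.inl x.1.1) (Sum.inl x.1.2)
  map_add' S T := by
    ext x
    simp only [Submodule.coe_add, Matrix.add_apply, Pi.add_apply]
    ring
  map_smul' t S := by
    ext x
    simp only [Submodule.coe_smul, Matrix.smul_apply, Pi.smul_apply, smul_eq_mul,
      RingHom.id_apply]
    ring
  invFun M := ⟨ofPair M, ofPair_mem hp hr M⟩
  left_inv := by
    rintro ⟨S, hS⟩
    refine Subtype.ext ?_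
    obtain ⟨A, B, C, D, rfl⟩ : ∃ A B C D, S = fromBlocks A B C D :=
      ⟨_, _, _, _, (fromBlocks_toBlocks S).symm⟩
    obtain ⟨h1, h2, h3, h4, h5, h6⟩ := fromBlocks_mem_lieAlg.mp hS
    simp only [fromBlocks_apply₂₁, fromBlocks_apply₁₁]
    have hM : ∀ i j, extendPair (fun x : ClassPair b p r => C x.1.1 x.1.2 + p x.1.1 * A x.1.1 x.1.2)
        i j = C i j + p i * A i j := by
      intro i j
      rw [extendPair]
      split_ifs with h
      · rfl
      · obtain ⟨hA, hC⟩ := lieAlg_apply_eq_zero hb hp hr hS h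
        rw [hA, hC, mul_zero, add_zero]
    have hC : ∀ i j, C i j = C j i := by
      intro i j
      by_cases h : b i = b j ∧ p i * r i = p j * r j
      · refine mul_left_cancel₀ (hb i).ne' ?_
        have := h4 i j
        rw [← h.1] at this
        linarith
      · rw [(lieAlg_apply_eq_zero hb hp hr hS h).2, (lieAlg_apply_eq_zero hb hp hr hS
          fun h' => h ⟨h'.1.symm, h'.2.symm⟩).2]
    have hD : ∀ i j, D i j = -A j i := by
      intro i j
      have h0 := h5 i j
      by_cases h : b i = b j ∧ p i * r i = p j * r j
      · refine mul_left_cancel₀ (hb i).ne' ?_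
        rw [← h.1] at h0
        linarith
      · rw [(lieAlg_apply_eq_zero hb hp hr hS fun h' => h ⟨h'.1.symm, h'.2.symm⟩).1] at h0 ⊢
        refine mul_left_cancel₀ (hb i).ne' ?_
        linarith
    rw [ofPair, fromBlocks_inj]
    simp only [hM]
    refine ⟨?_, ?_, ?_, ?_⟩ <;> ext i j <;> simp only [of_apply]
    · linear_combination p i / 2 * hC i j - p i / 2 * h1 i j + A i j * mul_self_eq_one_of_sign (hp i)
    · linear_combination -p i * r j / 2 * hC i j - p i * r j / 2 * h1 i j - p i * h2 i j +
        B i j * mul_self_eq_one_of_sign (hp i)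
    · linear_combination 1 / 2 * h1 i j - 1 / 2 * hC i j
    · linear_combination p j / 2 * hC i j + p j / 2 * h1 i j - hD i j -
        A j i * mul_self_eq_one_of_sign (hp j)
  right_inv M := by
    ext ⟨⟨i, j⟩, h⟩
    simp only [ofPair, fromBlocks_apply₂₁, fromBlocks_apply₁₁, of_apply]
    have hM : extendPair M i j = M ⟨(i, j), h⟩ := dif_pos h
    rw [← hM]
    linear_combination (extendPair M i j - extendPair M j i) / 2 * mul_self_eq_one_of_sign (hp i)

theorem card_kernelPair {α β : Type*} [Fintype α] [Fintype β] [DecidableEq β] (κ : α → β) :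
    Nat.card {x : α × α // κ x.1 = κ x.2} = ∑ y, Nat.card {a // κ a = y} ^ 2 := by
  let e : {x : α × α // κ x.1 = κ x.2} ≃ Σ y, {a // κ a = y} × {a // κ a = y} :=
    { toFun := fun x => ⟨κ x.1.1, ⟨x.1.1, rfl⟩, ⟨x.1.2, x.2.symm⟩⟩
      invFun := fun z => ⟨(z.2.1.1, z.2.2.1), z.2.1.2.trans z.2.2.2.symm⟩
      left_inv := fun _ => rfl
      right_inv := by
        rintro ⟨_, ⟨a, rfl⟩, ⟨a', h⟩⟩
        rfl }
  rw [Nat.card_congr e, Nat.card_sigma]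
  refine Finset.sum_congr rfl fun y _ => ?_
  rw [Nat.card_prod, sq]

theorem card_block {n : ℕ} (c : Composition n) (i : Fin c.length) :
    Nat.card {j // c.index j = i} = c.blocksFun i := by
  have : {j | c.index j = i} = Set.range (c.embedding i) := by
    ext j
    exact (c.mem_range_embedding_iff'.trans eq_comm).symm
  calc Nat.card {j // c.index j = i} = Nat.card (Set.range (c.embedding i)) :=
        Nat.card_congr (Equiv.setCongr this)
    _ = c.blocksFun i := by
        rw [Nat.card_range_of_injective (c.embedding i).injective, Nat.card_fin]

/-- The pairs are those on which the map to (block, sign of `p r`) agrees, and each fibre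
contributes the square of its size. -/
theorem card_classPair {n : ℕ} (c : Composition n) {b p r : Fin n → ℝ}
    (hreg : ∀ j j', b j = b j' ↔ c.index j = c.index j')
    (hp : ∀ j, p j = -1 ∨ p j = 1) (hr : ∀ j, r j = -1 ∨ r j = 1) :
    (Nat.card (ClassPair b p r) : ℝ) = ∑ i,
      ((Nat.card {j // c.index j = i ∧ p j * r j = 1} : ℝ) ^ 2 +
        (c.blocksFun i - Nat.card {j // c.index j = i ∧ p j * r j = 1} : ℝ) ^ 2) := by
  classical
  have hsign : ∀ j, p j * r j = -1 ∨ p j * r j = 1 := by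
    intro j
    rcases hp j with h | h <;> rcases hr j with h' | h' <;> simp [h, h']
  let κ : Fin n → Fin c.length × Bool := fun j => (c.index j, decide (p j * r j = 1))
  have e : ClassPair b p r ≃ {x : Fin n × Fin n // κ x.1 = κ x.2} :=
    Equiv.subtypeEquivRight fun x => by
      rw [hreg, Prod.mk.injEq, decide_eq_decide]
      refine and_congr_right fun _ => ⟨fun h => by rw [h], fun h => ?_⟩
      rcases hsign x.1 with h1 | h1
      · rcases hsign x.2 with h2 | h2
        · rw [h1, h2]
        · exact (h.mpr h2).trans h2.symm
      · exact h1.trans (h.mp h1).symm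
  rw [Nat.card_congr e, card_kernelPair, Fintype.sum_prod_type]
  push_cast
  refine Finset.sum_congr rfl fun i _ => ?_
  rw [Fintype.sum_bool]
  have h1 : Nat.card {a // κ a = (i, true)} = Nat.card {j // c.index j = i ∧ p j * r j = 1} :=
    Nat.card_congr (Equiv.subtypeEquivRight fun j => by simp [κ])
  have h2 : Nat.card {a // κ a = (i, false)} = Nat.card {j // c.index j = i ∧ ¬p j * r j = 1} :=
    Nat.card_congr (Equiv.subtypeEquivRight fun j => by simp [κ])
  have h3 : c.blocksFun i = Nat.card {j // c.index j = i ∧ p j * r j = 1} +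
      Nat.card {j // c.index j = i ∧ ¬p j * r j = 1} := by
    rw [← card_block]
    simp only [Nat.card_eq_fintype_card, Fintype.card_subtype]
    rw [← Finset.card_filter_add_card_filter_not (fun j => p j * r j = 1), Finset.filter_filter,
      Finset.filter_filter]
  rw [h1, h2, h3]
  push_cast
  ring

/-! ### The ranks of `Hⁱ ∩ Ĥ` -/

theorem finrank_eq_card_of_mem_iff {m : Type*} [Fintype m] [DecidableEq m]
    (V : Submodule ℝ (m → ℝ)) (I : Set m) (hV : ∀ v, v ∈ V ↔ ∀ k, k ∉ I → v k = 0) :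
    Module.finrank ℝ V = Nat.card I := by
  classical
  have h : V = ⨅ k ∈ Iᶜ, LinearMap.ker (LinearMap.proj k : (m → ℝ) →ₗ[ℝ] ℝ) := by
    ext v
    rw [hV]
    simp [Submodule.mem_iInf]
  rw [h, (LinearMap.iInfKerProjEquiv ℝ (fun _ : m => ℝ) (I := I) (J := Iᶜ)
    disjoint_compl_right (by simp)).finrank_eq, Module.finrank_fintype_fun_eq_card,
    Nat.card_eq_fintype_card]

theorem mem_blockSpace_iff {n : ℕ} {c : Composition n} {i : Fin c.length}
    {v : Fin n ⊕ Fin n → ℝ} :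
    v ∈ blockSpace c i ↔ ∀ k, blockIndex c k ≠ i → v k = 0 := by
  constructor
  · intro h k hk
    have : blockSpace c i ≤ LinearMap.ker (LinearMap.proj k : (Fin n ⊕ Fin n → ℝ) →ₗ[ℝ] ℝ) := by
      refine Submodule.span_le.mpr ?_
      rintro _ ⟨l, rfl⟩
      refine Pi.single_eq_of_ne ?_ _
      rintro rfl
      exact hk (blockIndex_emb c i l)
    exact this h
  · intro h
    rw [pi_eq_sum_univ' v]
    refine Submodule.sum_mem _ fun k _ => ?_
    by_cases hk : blockIndex c k = i
    · obtain ⟨l, rfl⟩ := mem_range_emb.mpr hk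
      exact Submodule.smul_mem _ _ (Submodule.subset_span ⟨l, rfl⟩)
    · rw [h k hk, zero_smul]
      exact Submodule.zero_mem _

/-- `J²` is diagonal, and its entries are negative exactly where `p r = 1`. So `Ĥ` is a coordinate
subspace. -/
theorem mem_hatH_iff {n : ℕ} {b p r : Fin n → ℝ} (hb : ∀ j, 0 < b j)
    (hp : ∀ j, p j = -1 ∨ p j = 1) (hr : ∀ j, r j = -1 ∨ r j = 1) {v : Fin n ⊕ Fin n → ℝ} :
    v ∈ hatH b p r ↔ ∀ k, ¬Sum.elim p p k * Sum.elim r r k = 1 → v k = 0 := by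
  have hsq : ∀ k, sqJ b p r k = -(Sum.elim p p k * Sum.elim r r k * Sum.elim b b k ^ 2) := by
    rintro (k | k) <;> rfl
  have hbk : ∀ k, 0 < Sum.elim b b k := by
    rintro (k | k) <;> exact hb k
  have hsign : ∀ k, ¬Sum.elim p p k * Sum.elim r r k = 1 →
      Sum.elim p p k * Sum.elim r r k = -1 := by
    rintro (k | k) h <;>
      rcases hp k with h1 | h1 <;> rcases hr k with h2 | h2 <;> simp_all
  rw [hatH, opJ_mul_opJ hp hr]
  constructor
  · intro h k hk
    have : (⨆ (β : ℝ) (_ : 0 < β), Module.End.eigenspace (Matrix.toLin' (diagonal (sqJ b p r)))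
        (-β ^ 2)) ≤ LinearMap.ker (LinearMap.proj k : (Fin n ⊕ Fin n → ℝ) →ₗ[ℝ] ℝ) := by
      refine iSup₂_le fun β hβ w hw => ?_
      rw [Module.End.mem_eigenspace_iff] at hw
      have h1 := congrFun hw k
      rw [Matrix.toLin'_apply, mulVec_diagonal, hsq, hsign k hk, Pi.smul_apply, smul_eq_mul] at h1
      have h2 : (Sum.elim b b k ^ 2 + β ^ 2) * w k = 0 := by linear_combination h1
      exact (mul_eq_zero.mp h2).resolve_left (by have := hbk k; positivity)
    exact this h
  · intro h
    rw [pi_eq_sum_univ' v]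
    refine Submodule.sum_mem _ fun k _ => ?_
    by_cases hk : Sum.elim p p k * Sum.elim r r k = 1
    · refine Submodule.smul_mem _ _ ?_
      refine Submodule.mem_iSup_of_mem (Sum.elim b b k) (Submodule.mem_iSup_of_mem (hbk k) ?_)
      rw [Module.End.mem_eigenspace_iff]
      ext l
      rw [Matrix.toLin'_apply, mulVec_diagonal, Pi.smul_apply, smul_eq_mul]
      by_cases hl : l = k
      · rw [hl, hsq, hk, one_mul]
      · rw [Pi.single_eq_of_ne hl, mul_zero, mul_zero]
    · rw [h k hk, zero_smul]
      exact Submodule.zero_mem _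

theorem halfRank_eq {n : ℕ} (c : Composition n) {b p r : Fin n → ℝ} (hb : ∀ j, 0 < b j)
    (hp : ∀ j, p j = -1 ∨ p j = 1) (hr : ∀ j, r j = -1 ∨ r j = 1) (i : Fin c.length) :
    halfRank c b p r i = Nat.card {j // c.index j = i ∧ p j * r j = 1} := by
  have h := finrank_eq_card_of_mem_iff (blockSpace c i ⊓ hatH b p r)
    {k | blockIndex c k = i ∧ Sum.elim p p k * Sum.elim r r k = 1} fun v => by
      rw [Submodule.mem_inf, mem_blockSpace_iff, mem_hatH_iff hb hp hr, ← forall_and]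
      refine forall_congr' fun k => ?_
      rw [Set.mem_ofPred_eq, not_and_or, or_imp]
  -- Each index `j` contributes both `X_j` and `Y_j`, which accounts for the factor `½` in `s_i`.
  have e : {k | blockIndex c k = i ∧ Sum.elim p p k * Sum.elim r r k = 1} ≃
      {j // c.index j = i ∧ p j * r j = 1} ⊕ {j // c.index j = i ∧ p j * r j = 1} :=
    Equiv.subtypeSum
  rw [halfRank, h, Nat.card_congr e, Nat.card_sum]
  push_cast
  ring

theorem finrank_lieAlg {n : ℕ} (c : Composition n) {b p r : Fin n → ℝ} (hb : ∀ j, 0 < b j)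
    (hreg : ∀ j j', b j = b j' ↔ c.index j = c.index j')
    (hp : ∀ j, p j = -1 ∨ p j = 1) (hr : ∀ j, r j = -1 ∨ r j = 1) :
    (Module.finrank ℝ (lieAlg b p r) : ℝ) =
      ∑ i, (halfRank c b p r i ^ 2 + ((c.blocksFun i : ℝ) - halfRank c b p r i) ^ 2) := by
  classical
  simp only [halfRank_eq c hb hp hr]
  rw [(lieAlgEquiv hb hp hr).finrank_eq, Module.finrank_fintype_fun_eq_card,
    ← Nat.card_eq_fintype_card, card_classPair c hreg hp hr]


/-! ### The infinitesimal isometries -/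

theorem transpose_mul_add_mul_eq_zero_iff {m : Type*} [Fintype m] [DecidableEq m]
    (S G : Matrix m m ℝ) : Sᵀ * G + G * S = 0 ↔
      ∀ u v, gramForm G (S *ᵥ u) v + gramForm G u (S *ᵥ v) = 0 := by
  have key : ∀ u v, gramForm G (S *ᵥ u) v + gramForm G u (S *ᵥ v) =
      u ⬝ᵥ (Sᵀ * G + G * S) *ᵥ v := by
    intro u v
    rw [gramForm_apply, gramForm_apply, Matrix.add_mulVec, dotProduct_add, ← Matrix.mulVec_mulVec,
      ← Matrix.mulVec_mulVec, Matrix.dotProduct_mulVec _ (_ᵀ), Matrix.vecMul_transpose]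
  constructor
  · intro h u v
    rw [key, h, zero_mulVec, dotProduct_zero]
  · intro h
    ext i j
    have := (key (Pi.single i 1) (Pi.single j 1)).symm.trans (h _ _)
    simpa using this

/-- The vector field generated by the translation in the direction `a` and the linear vector field
with the matrix `S`. -/
noncomputable def genField {n : ℕ} (b p r : Fin n → ℝ) :
    (Coord n × lieAlg b p r) →ₗ[ℝ] (Coord n → Coord n) where
  toFun x q := (x.1.1 + x.2.1 *ᵥ q.1, x.1.2 - 1 / 2 * symp b x.1.1 q.1)
  map_add' x y := by
    ext q : 1
    refine Prod.ext ?_ ?_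
    · simp only [Prod.fst_add, Prod.snd_add, Submodule.coe_add, Matrix.add_mulVec, Pi.add_apply]
      abel
    · simp only [Prod.fst_add, Prod.snd_add, symp_add_left, Pi.add_apply]
      ring
  map_smul' t x := by
    ext q : 1
    refine Prod.ext ?_ ?_
    · simp [Matrix.smul_mulVec]
    · simp only [symp_eq_gramForm, Prod.smul_fst, Prod.smul_snd, map_smul, Pi.smul_apply,
        RingHom.id_apply, _root_.smul_apply, smul_eq_mul]
      ring

theorem genField_apply {n : ℕ} {b p r : Fin n → ℝ} (x : Coord n × lieAlg b p r) (q : Coord n) :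
    genField b p r x q = (x.1.1 + x.2.1 *ᵥ q.1, x.1.2 - 1 / 2 * symp b x.1.1 q.1) :=
  rfl

theorem genField_injective {n : ℕ} (b p r : Fin n → ℝ) :
    Function.Injective (genField b p r) := by
  refine (injective_iff_map_eq_zero _).mpr fun x hx => ?_
  have h0 := congrFun hx 0
  rw [genField_apply] at h0
  have h1 : x.1.1 = 0 := by simpa using congrArg Prod.fst h0
  have h2 : x.1.2 = 0 := by simpa [symp_zero_right] using congrArg Prod.snd h0
  refine Prod.ext (Prod.ext h1 h2) (Subtype.ext (Matrix.ext_iff_mulVec.mpr fun u => ?_))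
  have h3 := congrArg Prod.fst (congrFun hx (u, 0))
  simpa [genField_apply, h1] using h3

/-- The factor of `f ∘ f` is `μ² = 1`, found by following the `z`-axis. Applied to `φ_t = φ_{t/2}²`,
this excludes `μ = -1` without a connectedness argument. -/
theorem IsIsometry.exists_eq_of_mul_self {n : ℕ} (hn : 1 ≤ n) {b p r : Fin n → ℝ}
    (hb : ∀ j, 0 < b j) (hp : ∀ j, p j = -1 ∨ p j = 1) (hr : ∀ j, r j = -1 ∨ r j = 1)
    {f : Equiv.Perm (Coord n)} (hf : IsIsometry b p r f) :
    ∃ A : Matrix (Fin n ⊕ Fin n) (Fin n ⊕ Fin n) ℝ,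
      Aᵀ * gramMetric p r * A = gramMetric p r ∧ Aᵀ * gramSymp b * A = gramSymp b ∧
      ∀ q, (f * f) q = (f * f) 0 + affineDeriv b A ((f * f) 0).1 q := by
  obtain ⟨A, μ, -, -, hμ, h⟩ := hf.exists_eq hn hb hp hr
  obtain ⟨B, ν, hG, hΩ, -, h'⟩ := (hf.mul hf).exists_eq hn hb hp hr
  have key : ∀ q s, f (q + (0, s)) = f q + (0, μ * s) := by
    intro q s
    rw [h, h q]
    refine Prod.ext (by simp) ?_
    simp only [Prod.fst_add, Prod.snd_add, add_zero]
    ring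
  have h1 : (f * f) (0, 1) = (f * f) 0 + (0, μ * μ) := by
    have := key 0 1
    rw [zero_add, mul_one] at this
    rw [Equiv.Perm.mul_apply, this, key]
    rfl
  have h2 := congrArg Prod.snd (h' (0, 1))
  rw [h1] at h2
  have hν : ν = 1 := by
    have hμ2 : μ * μ = 1 := by rcases hμ with h | h <;> simp [h]
    simp only [Prod.snd_add, hμ2, Matrix.mulVec_zero, symp_zero_right] at h2
    linarith
  rw [hν, one_smul] at hΩ
  refine ⟨B, hG, hΩ, fun q => ?_⟩
  rw [h', hν, affineDeriv_apply]
  refine Prod.ext rfl ?_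
  simp only [Prod.snd_add]
  ring

theorem infinitesimalIsometries_subset {n : ℕ} (hn : 1 ≤ n) {b p r : Fin n → ℝ}
    (hb : ∀ j, 0 < b j) (hp : ∀ j, p j = -1 ∨ p j = 1) (hr : ∀ j, r j = -1 ∨ r j = 1) :
    infinitesimalIsometries b p r ⊆ LinearMap.range (genField b p r) := by
  rintro V ⟨φ, hφ, hV⟩
  set F : ℝ → Coord n → Coord n := fun t => (φ (Multiplicative.ofAdd t)).1 with hF
  have hF0 : ∀ q, F 0 q = q := fun q => by
    rw [hF]
    simp only [ofAdd_zero, map_one]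
    rfl
  have hA : ∀ t, ∃ A : Matrix (Fin n ⊕ Fin n) (Fin n ⊕ Fin n) ℝ,
      Aᵀ * gramMetric p r * A = gramMetric p r ∧ Aᵀ * gramSymp b * A = gramSymp b ∧
      ∀ q, F t q = F t 0 + affineDeriv b A (F t 0).1 q := by
    intro t
    have h := (φ (Multiplicative.ofAdd (t / 2))).2.exists_eq_of_mul_self hn hb hp hr
    have h2 : (φ (Multiplicative.ofAdd (t / 2))).1 * (φ (Multiplicative.ofAdd (t / 2))).1 =
        (φ (Multiplicative.ofAdd t)).1 := by
      rw [← Subgroup.coe_mul, ← map_mul, ← ofAdd_add, add_halves]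
    rw [h2] at h
    exact h
  choose A hG hΩ hFA using hA
  have hVd : ∀ q, HasDerivAt (fun t => F t q) (V q) 0 := fun q => by
    rw [hV q]
    have : ContDiff ℝ ∞ fun t => F t q := hφ.comp (contDiff_id.prodMk contDiff_const)
    exact ((this.differentiable (by simp)) 0).hasDerivAt
  have hVd1 : ∀ q, HasDerivAt (fun t => (F t q).1) (V q).1 0 := fun q =>
    (ContinuousLinearMap.fst ℝ (Fin n ⊕ Fin n → ℝ) ℝ).hasFDerivAt.comp_hasDerivAt 0 (hVd q)
  have hVd2 : ∀ q, HasDerivAt (fun t => (F t q).2) (V q).2 0 := fun q =>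
    (ContinuousLinearMap.snd ℝ (Fin n ⊕ Fin n → ℝ) ℝ).hasFDerivAt.comp_hasDerivAt 0 (hVd q)
  have hAu : ∀ t u, A t *ᵥ u = (F t (u, 0)).1 - (F t 0).1 := fun t u => by
    rw [hFA t (u, 0), affineDeriv_apply, Prod.fst_add, add_sub_cancel_left]
  have hA0 : ∀ u, A 0 *ᵥ u = u := fun u => by
    rw [hAu, hF0, hF0]
    exact sub_zero u
  -- The columns of `A t` are differences of values of the flow at basis vectors and at the origin,
  -- so their derivatives are differences of values of `V`.
  let S : Matrix (Fin n ⊕ Fin n) (Fin n ⊕ Fin n) ℝ :=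
    of fun k l => (V (Pi.single l 1, 0)).1 k - (V 0).1 k
  have hAd : ∀ u, HasDerivAt (fun t => A t *ᵥ u) (S *ᵥ u) 0 := by
    intro u
    have h1 : ∀ l, HasDerivAt (fun t => A t *ᵥ Pi.single l 1)
        ((V (Pi.single l 1, 0)).1 - (V 0).1) 0 := fun l => by
      simp only [hAu]
      exact (hVd1 _).sub (hVd1 _)
    have h2 : ∀ t, A t *ᵥ u = ∑ l, u l • (A t *ᵥ Pi.single l 1) := fun t => by
      conv_lhs => rw [pi_eq_sum_univ' u, mulVec_sum]
      simp only [mulVec_smul]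
    have h3 : S *ᵥ u = ∑ l, u l • ((V (Pi.single l 1, 0)).1 - (V 0).1) := by
      ext k
      simp [S, mulVec, dotProduct, mul_comm]
    simp only [h2, h3]
    exact HasDerivAt.fun_sum fun l _ => (h1 l).const_smul (u l)
  -- Differentiate the constant function `G(A t u, A t v)` at `t = 0`, where `A 0` is the identity.
  have hS : ∀ G : Matrix (Fin n ⊕ Fin n) (Fin n ⊕ Fin n) ℝ, (∀ t, (A t)ᵀ * G * A t = G) →
      Sᵀ * G + G * S = 0 := by
    intro G h
    rw [transpose_mul_add_mul_eq_zero_iff]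
    intro u v
    have h1 := (gramForm G).hasDerivAt_of_bilinear (fun _ => hAd u) (fun _ => hAd v)
    have h2 : (fun t => gramForm G (A t *ᵥ u) (A t *ᵥ v)) = fun _ => gramForm G u v := by
      funext t
      rw [gramForm_apply, gramForm_apply]
      exact (transpose_mul_mul_eq_iff _ _ _).mp (h t) u v
    rw [h2] at h1
    have h3 := h1.unique (hasDerivAt_const _ _)
    rw [hA0, hA0] at h3
    rw [add_comm]
    exact h3
  refine ⟨((V 0), ⟨S, hS _ hG, hS _ hΩ⟩), funext fun q => ?_⟩
  rw [genField_apply]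
  have h1 := (hVd1 0).add (hAd q.1)
  have h2 := (gramForm (gramSymp b)).hasDerivAt_of_bilinear (fun _ => hVd1 0) (fun _ => hAd q.1)
  have h3 := ((hVd2 0).add_const q.2).sub (h2.const_mul (1 / 2 : ℝ))
  have h4 := h1.prodMk h3
  have h5 := HasDerivAt.unique (hVd q) (h4.congr_of_eventuallyEq
    (Filter.Eventually.of_forall fun t => ?_))
  · rw [h5, hA0, hF0, symp_eq_gramForm]
    simp
  · beta_reduce
    rw [hFA t q, affineDeriv_apply, symp_eq_gramForm]
    refine Prod.ext rfl ?_
    simp only [Prod.snd_add, Pi.sub_apply]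
    ring

theorem mem_infinitesimalIsometries_of_flow {n : ℕ} {b p r : Fin n → ℝ}
    (hb : ∀ j, 0 < b j) (hp : ∀ j, p j = -1 ∨ p j = 1) (hr : ∀ j, r j = -1 ∨ r j = 1)
    {A : ℝ → Matrix (Fin n ⊕ Fin n) (Fin n ⊕ Fin n) ℝ} {a : ℝ → Coord n}
    {F : ℝ → Coord n → Coord n} {V : Coord n → Coord n}
    (hG : ∀ t, (A t)ᵀ * gramMetric p r * A t = gramMetric p r)
    (hΩ : ∀ t, (A t)ᵀ * gramSymp b * A t = gramSymp b)
    (hF : ∀ t q, F t q = a t + affineDeriv b (A t) (a t).1 q) (h0 : ∀ q, F 0 q = q)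
    (hadd : ∀ s t q, F (s + t) q = F s (F t q))
    (hs : ContDiff ℝ ∞ fun x : ℝ × Coord n => F x.1 x.2)
    (hV : ∀ q, HasDerivAt (fun t => F t q) (V q) 0) : V ∈ infinitesimalIsometries b p r := by
  let f : ℝ → Equiv.Perm (Coord n) := fun t =>
    ⟨F t, F (-t), fun q => by rw [← hadd, neg_add_cancel, h0],
      fun q => by rw [← hadd, add_neg_cancel, h0]⟩
  have hsm : ∀ t, ContDiff ℝ ∞ (F t) := fun t => hs.comp (contDiff_const.prodMk contDiff_id)
  have hf : ∀ t, IsIsometry b p r (f t) := fun t =>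
    (isIsometry_and_orientation_of_affine hb hp hr (hG t) (hΩ t) (f := f t) (a := a t) (hF t)
      (hsm (-t))).1
  let φ : Multiplicative ℝ →* isometryGroup b p r :=
    { toFun := fun t => ⟨f t.toAdd, hf _⟩
      map_one' := Subtype.ext (Equiv.ext h0)
      map_mul' := fun s t => Subtype.ext (Equiv.ext (hadd s.toAdd t.toAdd)) }
  exact ⟨φ, hs, fun q => (hV q).deriv.symm⟩

theorem genField_translation_mem {n : ℕ} {b p r : Fin n → ℝ}
    (hb : ∀ j, 0 < b j) (hp : ∀ j, p j = -1 ∨ p j = 1) (hr : ∀ j, r j = -1 ∨ r j = 1)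
    (a : Coord n) : genField b p r (a, 0) ∈ infinitesimalIsometries b p r := by
  have hF : ∀ (t : ℝ) (q : Coord n), t • a + affineDeriv b 1 (t • a).1 q =
      q + t • (a.1, a.2 - 1 / 2 * gramForm (gramSymp b) a.1 q.1) := by
    intro t q
    rw [affineDeriv_apply, Matrix.one_mulVec, symp_eq_gramForm]
    refine Prod.ext (add_comm _ _) ?_
    simp only [Prod.snd_add, Prod.smul_snd, Prod.smul_fst, map_smul, _root_.smul_apply, smul_eq_mul]
    ring
  refine mem_infinitesimalIsometries_of_flow hb hp hr (A := fun _ => 1) (a := fun t => t • a)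
    (F := fun t q => q + t • (a.1, a.2 - 1 / 2 * gramForm (gramSymp b) a.1 q.1))
    (by simp) (by simp) (fun t q => (hF t q).symm) (by simp) (fun s t q => ?_) ?_ (fun q => ?_)
  · have h : gramForm (gramSymp b) a.1 a.1 = 0 := by rw [← symp_eq_gramForm, symp_self]
    refine Prod.ext ?_ ?_
    · simp only [Prod.fst_add, Prod.smul_fst, add_smul]
      abel
    · simp only [Prod.snd_add, Prod.smul_snd, Prod.fst_add, Prod.smul_fst, map_add, map_smul, h,
        smul_eq_mul]
      ring
  · have h1 : ContDiff ℝ ∞ fun x : ℝ × Coord n => gramForm (gramSymp b) a.1 x.2.1 :=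
      (gramForm (gramSymp b) a.1).contDiff.comp (contDiff_fst.comp contDiff_snd)
    fun_prop
  · rw [genField_apply, symp_eq_gramForm]
    simpa using (((hasDerivAt_id (0 : ℝ)).smul_const
      (a.1, a.2 - 1 / 2 * gramForm (gramSymp b) a.1 q.1)).const_add q)

/-- The flow is `exp(tS)` on `(x,y)`. It preserves both forms because their derivatives along it
vanish. -/
theorem genField_linear_mem {n : ℕ} {b p r : Fin n → ℝ}
    (hb : ∀ j, 0 < b j) (hp : ∀ j, p j = -1 ∨ p j = 1) (hr : ∀ j, r j = -1 ∨ r j = 1)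
    (S : lieAlg b p r) : genField b p r (0, S) ∈ infinitesimalIsometries b p r := by
  set T : (Fin n ⊕ Fin n → ℝ) →L[ℝ] (Fin n ⊕ Fin n → ℝ) :=
    LinearMap.toContinuousLinearMap (Matrix.toLin' S.1) with hT
  have hTu : ∀ u, T u = S.1 *ᵥ u := fun u => rfl
  set U : ℝ → (Fin n ⊕ Fin n → ℝ) →L[ℝ] (Fin n ⊕ Fin n → ℝ) := fun t => NormedSpace.exp (t • T)
    with hU
  have hUd : ∀ t u, HasDerivAt (fun t => U t u) (T (U t u)) t := fun t u => by
    have := (hasDerivAt_exp_smul_const' (𝕂 := ℝ) T t).clm_apply (hasDerivAt_const t u)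
    simpa using this
  have hU0 : ∀ u, U 0 u = u := fun u => by simp [hU]
  have hUadd : ∀ s t u, U (s + t) u = U s (U t u) := fun s t u => by
    have : U (s + t) = U s * U t := by
      simp only [hU, add_smul]
      let _ : NormedAlgebra ℚ ((Fin n ⊕ Fin n → ℝ) →L[ℝ] (Fin n ⊕ Fin n → ℝ)) :=
        NormedAlgebra.restrictScalars ℚ ℝ _
      exact NormedSpace.exp_add_of_commute (((Commute.refl T).smul_left s).smul_right t)
    rw [this]
    rfl
  have hUs : ContDiff ℝ ∞ U :=
    (AnalyticOnNhd.contDiff fun x _ => NormedSpace.exp_analytic (𝕂 := ℝ) x).comp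
      (contDiff_id.smul contDiff_const)
  let A : ℝ → Matrix (Fin n ⊕ Fin n) (Fin n ⊕ Fin n) ℝ := fun t =>
    LinearMap.toMatrix' (U t).toLinearMap
  have hAu : ∀ t u, A t *ᵥ u = U t u := fun t u => LinearMap.toMatrix'_mulVec _ _
  have hpres : ∀ G : Matrix (Fin n ⊕ Fin n) (Fin n ⊕ Fin n) ℝ, S.1ᵀ * G + G * S.1 = 0 →
      ∀ t, (A t)ᵀ * G * A t = G := by
    intro G hG t
    rw [transpose_mul_add_mul_eq_zero_iff] at hG
    rw [transpose_mul_mul_eq_iff]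
    intro u v
    have h1 : ∀ t, HasDerivAt (fun t => gramForm G (U t u) (U t v)) 0 t := fun t => by
      have h2 := (gramForm G).hasDerivAt_of_bilinear (fun _ => hUd t u) (fun _ => hUd t v)
      rwa [hTu, hTu, add_comm, hG] at h2
    have h3 := is_const_of_deriv_eq_zero (fun t => (h1 t).differentiableAt)
      (fun t => (h1 t).deriv) t 0
    rw [hU0, hU0] at h3
    rw [hAu, hAu, ← gramForm_apply, ← gramForm_apply, h3]
  refine mem_infinitesimalIsometries_of_flow hb hp hr (A := A) (a := fun _ => 0)
    (F := fun t q => (U t q.1, q.2)) (hpres _ S.2.1) (hpres _ S.2.2) (fun t q => ?_)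
    (fun q => Prod.ext (hU0 q.1) rfl) (fun s t q => Prod.ext (hUadd s t q.1) rfl) ?_ (fun q => ?_)
  · rw [affineDeriv_apply, hAu]
    simp [symp_zero_left]
  · exact ((hUs.comp contDiff_fst).clm_apply (contDiff_fst.comp contDiff_snd)).prodMk
      (contDiff_snd.comp contDiff_snd)
  · rw [genField_apply]
    have := (hUd 0 q.1).prodMk (hasDerivAt_const (0 : ℝ) q.2)
    rw [hU0, hTu] at this
    simpa [symp_zero_left] using this

/-- For the span it is enough to integrate translation fields and linear fields separately. No flow
for their sum is needed. -/
theorem span_infinitesimalIsometries {n : ℕ} (hn : 1 ≤ n) {b p r : Fin n → ℝ}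
    (hb : ∀ j, 0 < b j) (hp : ∀ j, p j = -1 ∨ p j = 1) (hr : ∀ j, r j = -1 ∨ r j = 1) :
    Submodule.span ℝ (infinitesimalIsometries b p r) = LinearMap.range (genField b p r) := by
  refine le_antisymm (Submodule.span_le.mpr (infinitesimalIsometries_subset hn hb hp hr)) ?_
  rintro _ ⟨⟨a, S⟩, rfl⟩
  have : (a, S) = (a, (0 : lieAlg b p r)) + ((0 : Coord n), S) := by simp
  rw [this, map_add]
  exact Submodule.add_mem _ (Submodule.subset_span (genField_translation_mem hb hp hr a))
    (Submodule.subset_span (genField_linear_mem hb hp hr S))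

theorem isometryGroupDim_eq {n : ℕ} (hn : 1 ≤ n) {b p r : Fin n → ℝ}
    (hb : ∀ j, 0 < b j) (hp : ∀ j, p j = -1 ∨ p j = 1) (hr : ∀ j, r j = -1 ∨ r j = 1) :
    isometryGroupDim b p r = 2 * n + 1 + Module.finrank ℝ (lieAlg b p r) := by
  rw [isometryGroupDim, span_infinitesimalIsometries hn hb hp hr,
    LinearMap.finrank_range_of_inj (genField_injective b p r), Module.finrank_prod,
    Module.finrank_prod, Module.finrank_fintype_fun_eq_card, Module.finrank_self,
    Fintype.card_sum, Fintype.card_fin, two_mul]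

end SubPseudoRiem

/-! ### The isometry group and its dimension -/

open SubPseudoRiem in
theorem mainTheorem8 (n : ℕ) (hn : 1 ≤ n) (c : Composition n) (b p r : Fin n → ℝ)
    (hb : ∀ j, 0 < b j)
    (hreg : ∀ j j', b j = b j' ↔ c.index j = c.index j')
    (hp : ∀ j, p j = -1 ∨ p j = 1) (hr : ∀ j, r j = -1 ∨ r j = 1) :
    Nonempty ((Heis b ⋊[heisAction c b p r] StructureGroup c b p r) ≃ₜ*
        orientedIsometryGroup b p r) ∧
      (isometryGroupDim b p r : ℝ) = 2 * n + 1 +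
        ∑ i, (halfRank c b p r i ^ 2 + ((c.blocksFun i : ℝ) - halfRank c b p r i) ^ 2) := by
  refine ⟨nonempty_continuousMulEquiv hn c hb hreg hp hr, ?_⟩
  rw [isometryGroupDim_eq hn hb hp hr, ← finrank_lieAlg c hb hreg hp hr]
  push_cast
  rfl
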